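/- Consider the LTI system $\dot x(t)=Ax(t)+Bu(t)$, $x(0)=X_0z_0$, $y(t)=Cx(t)+Du(t)$, $t\ge 0$, with real matrices $A\in\mathbb R^{n\times n}$, $B\in\mathbb R^{n\times m}$, $C\in\mathbb R^{p\times n}$, $D\in\mathbb R^{p\times m}$, $X_0\in\mathbb R^{n\times q}$ and $z_0\in\mathbb R^q$, and assume that it is asymptotically stable, i.e. all eigenvalues of $A$ have negative real part. Let $\alpha,\beta>0$, $1\le r<n$, and put $\tilde B:=\begin{bmatrix}B & \frac{1}{\beta\sqrt{2\alpha}}(A+\alpha I_n)X_0\end{bmatrix}$. Let $V_r,W_r\in\mathbb R^{n\times r}$ and $\eta_1\ge\dots\ge\eta_n\ge 0$ be the projection matrices and Hankel singular values obtained by balanced truncation of $[A,\tilde B,C]$ to order $r$: if $AP+PA^{\mathsf T}+\tilde B\tilde B^{\mathsf T}=0$, $A^{\mathsf T}Q+QA+C^{\mathsf T}C=0$, $P=RR^{\mathsf T}$, $Q=LL^{\mathsf T}$ with $R,L\in\mathbb R^{n\times n}$, and $L^{\mathsf T}R=U\Sigma Z^{\mathsf T}$ is a singular value decomposition with $\Sigma=\operatorname{diag}(\eta_1,\dots,\eta_n)$,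 then $V_r=RZ_r\Sigma_r^{-1/2}$ and $W_r=LU_r\Sigma_r^{-1/2}$, where $Z_r,U_r$ consist of the first $r$ columns of $Z,U$ and $\Sigma_r=\operatorname{diag}(\eta_1,\dots,\eta_r)$. Assume $\eta_r>\eta_{r+1}$ (so $\Sigma_r$ is invertible) and that $-\alpha$ is not an eigenvalue of $A_r:=W_r^{\mathsf T}AV_r$. Define $B_r:=W_r^{\mathsf T}B$, $C_r:=CV_r$, $X_{0,r}:=(A_r+\alpha I_r)^{-1}W_r^{\mathsf T}(A+\alpha I_n)X_0$, $F_r:=CX_0-C_rX_{0,r}$, and the reduced model $$\dot x_r(t)=A_rx_r(t)+B_ru(t),\quad x_r(0)=X_{0,r}z_0,\qquad y_r(t)=C_rx_r(t)+Du(t)+F_rz_0e^{-\alpha t}.$$ Then the reduced model is asymptotically stable (all eigenvalues of $A_r$ have negative real part), and for all $z_0\in\mathbb R^q$ and all locally integrable inputs $u$ one has $y_r(0)=y(0)$ and, if $u\in\mathbb L_2([0,\infty),\mathbb R^m)$, then $y-y_r\in\mathbb L_2([0,\infty),\mathbb R^p)$ and $$\|y-y_r\|_{\mathbb L_2}\le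 2(\eta_{r+1}+\dots+\eta_n)\left(\|u\|_{\mathbb L_2}+\beta\|z_0\|_2\right).$$ -/

import Mathlib

open Matrix MeasureTheory

noncomputable section

namespace ShiftBT

/-- Asymptotic stability of `ẋ = A x + B u`: all complex eigenvalues of the real matrix `A`
lie in the open left half-plane. -/
def IsAsymptoticallyStable {n : ℕ} (A : Matrix (Fin n) (Fin n) ℝ) : Prop :=
  ∀ μ : ℂ, Module.End.HasEigenvalue (Matrix.toLin' (A.map Complex.ofReal)) μ → μ.re < 0

/-- `P` solves the controllability Lyapunov equation (the solution is unique for stable `A`). -/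
def IsControllabilityGramian {n : ℕ} {ι : Type*} [Fintype ι] (A : Matrix (Fin n) (Fin n) ℝ)
    (B : Matrix (Fin n) ι ℝ) (P : Matrix (Fin n) (Fin n) ℝ) : Prop :=
  A * P + P * Aᵀ + B * Bᵀ = 0

/-- `Q` solves the observability Lyapunov equation (the solution is unique for stable `A`). -/
def IsObservabilityGramian {n : ℕ} {ι : Type*} [Fintype ι] (A : Matrix (Fin n) (Fin n) ℝ)
    (C : Matrix ι (Fin n) ℝ) (Q : Matrix (Fin n) (Fin n) ℝ) : Prop :=
  Aᵀ * Q + Q * A + Cᵀ * C = 0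

/-- The first `r` columns of a square matrix. -/
def leadingCols {n r : ℕ} (hr : r ≤ n) (M : Matrix (Fin n) (Fin n) ℝ) :
    Matrix (Fin n) (Fin r) ℝ :=
  M.submatrix id (Fin.castLE hr)

/-- `[V, W, η₁, …, ηₙ]` is a result of square-root balanced truncation of `[A, B, C]` to order `r`:
with Gramians `P = R Rᵀ`, `Q = L Lᵀ` and a singular value decomposition `Lᵀ R = U Σ Zᵀ`,
`Σ = diag(η₁ ≥ … ≥ ηₙ ≥ 0)`, one has `V = R Z_r Σ_r^{-1/2}` and `W = L U_r Σ_r^{-1/2}`.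
The `ηᵢ` are the Hankel singular values (the square roots of the eigenvalues of `P Q`);
`η i` with `i : Fin n` is the `(i+1)`-st one. The projection matrices are not unique, hence a
relation. It is meant for `η_r > 0`, so that `Σ_r` is invertible. Low-rank factors of the Gramians
are covered by padding them with zero columns. -/
def IsBalancedTruncation {n r : ℕ} {ι κ : Type*} [Fintype ι] [Fintype κ]
    (A : Matrix (Fin n) (Fin n) ℝ) (B : Matrix (Fin n) ι ℝ) (C : Matrix κ (Fin n) ℝ)
    (hr : r ≤ n) (V W : Matrix (Fin n) (Fin r) ℝ) (η : Fin n → ℝ) : Prop :=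
  Antitone η ∧ (∀ i, 0 ≤ η i) ∧
  ∃ P Q R L U Z : Matrix (Fin n) (Fin n) ℝ,
    IsControllabilityGramian A B P ∧ IsObservabilityGramian A C Q ∧
    P = R * Rᵀ ∧ Q = L * Lᵀ ∧
    U ∈ Matrix.orthogonalGroup (Fin n) ℝ ∧ Z ∈ Matrix.orthogonalGroup (Fin n) ℝ ∧
    Lᵀ * R = U * Matrix.diagonal η * Zᵀ ∧
    V = R * leadingCols hr Z *
      Matrix.diagonal (fun i : Fin r => (Real.sqrt (η (Fin.castLE hr i)))⁻¹) ∧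
    W = L * leadingCols hr U *
      Matrix.diagonal (fun i : Fin r => (Real.sqrt (η (Fin.castLE hr i)))⁻¹)

/-- The expanded input matrix `[B, (A + α I) X₀ / (β √(2α))]`. -/
def expandedInput {n m q : ℕ} (A : Matrix (Fin n) (Fin n) ℝ) (B : Matrix (Fin n) (Fin m) ℝ)
    (X₀ : Matrix (Fin n) (Fin q) ℝ) (α β : ℝ) : Matrix (Fin n) (Fin m ⊕ Fin q) ℝ :=
  Matrix.fromCols B ((1 / (β * Real.sqrt (2 * α))) • ((A + α • (1 : Matrix (Fin n) (Fin n) ℝ)) * X₀))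

/-- A model `ẋ_r = A x_r + B u`, `x_r(0) = X₀ z₀`, `y_r = C x_r + D u + f`, where the output
correction `f z₀ t` may depend on `z₀`. -/
structure ReducedModel (r m p q : ℕ) where
  A : Matrix (Fin r) (Fin r) ℝ
  B : Matrix (Fin r) (Fin m) ℝ
  C : Matrix (Fin p) (Fin r) ℝ
  D : Matrix (Fin p) (Fin m) ℝ
  X₀ : Matrix (Fin r) (Fin q) ℝ
  f : (Fin q → ℝ) → ℝ → (Fin p → ℝ)

/-- The modified initial map `(A_r + α I)⁻¹ Wᵀ (A + α I) X₀`, with `A_r = Wᵀ A V`. -/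
def reducedInitialMap {n q r : ℕ} (A : Matrix (Fin n) (Fin n) ℝ) (X₀ : Matrix (Fin n) (Fin q) ℝ)
    (α : ℝ) (V W : Matrix (Fin n) (Fin r) ℝ) : Matrix (Fin r) (Fin q) ℝ :=
  (Wᵀ * A * V + α • (1 : Matrix (Fin r) (Fin r) ℝ))⁻¹ *
    (Wᵀ * (A + α • (1 : Matrix (Fin n) (Fin n) ℝ)) * X₀)

/-- The jShiftBT reduced model defined by projection matrices `V`, `W`. -/
def jShiftBT {n m p q r : ℕ} (A : Matrix (Fin n) (Fin n) ℝ) (B : Matrix (Fin n) (Fin m) ℝ)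
    (C : Matrix (Fin p) (Fin n) ℝ) (D : Matrix (Fin p) (Fin m) ℝ)
    (X₀ : Matrix (Fin n) (Fin q) ℝ) (α : ℝ) (V W : Matrix (Fin n) (Fin r) ℝ) :
    ReducedModel r m p q where
  A := Wᵀ * A * V
  B := Wᵀ * B
  C := C * V
  D := D
  X₀ := reducedInitialMap A X₀ α V W
  f := fun z₀ t =>
    Real.exp (-α * t) • ((C * X₀ - (C * V) * reducedInitialMap A X₀ α V W) *ᵥ z₀)

/-- `x` is the (Carathéodory) solution on `[0, ∞)` of `ẋ = A x + B u`, `x(0) = x₀`. -/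
def IsStateTrajectory {n m : ℕ} (A : Matrix (Fin n) (Fin n) ℝ) (B : Matrix (Fin n) (Fin m) ℝ)
    (u : ℝ → (Fin m → ℝ)) (x₀ : Fin n → ℝ) (x : ℝ → (Fin n → ℝ)) : Prop :=
  ContinuousOn x (Set.Ici 0) ∧
  ∀ t, 0 ≤ t →
    IntervalIntegrable (fun s => A *ᵥ x s + B *ᵥ u s) volume 0 t ∧
    x t = x₀ + ∫ s in (0 : ℝ)..t, (A *ᵥ x s + B *ᵥ u s)

/-- `g ∈ 𝕃₂ᵏ`, square integrability on `[0, ∞)`. -/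
def MemL2 {k : ℕ} (g : ℝ → (Fin k → ℝ)) : Prop :=
  AEStronglyMeasurable g (volume.restrict (Set.Ici 0)) ∧
  IntegrableOn (fun t => g t ⬝ᵥ g t) (Set.Ici 0) volume

/-- `‖g‖_{𝕃₂} = (∫₀^∞ g(t)ᵀ g(t) dt)^{1/2}`. -/
def normL2 {k : ℕ} (g : ℝ → (Fin k → ℝ)) : ℝ :=
  Real.sqrt (∫ t in Set.Ici (0 : ℝ), g t ⬝ᵥ g t)

end ShiftBT

end

/-! Subtracting `e^{-α t} X₀ z₀` from the state of the full model, and `e^{-α t} X_{0,r} z₀` from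
that of the reduced one, leaves zero initial states driven by the input `[u, β √(2α) e^{-α t} z₀]`
through `expandedInput` and its projection, and the correction `F_r` makes the output error equal to
the one of these two systems. The `L²` norm of the second input component is `β ‖z₀‖`, so the bound
is that of balanced truncation with zero initial state.

In balanced coordinates the Hankel singular values are truncated one at a time. Removing `η_k` costs
an error of at most `2 η_k ‖u‖`: with `ζ` and `ν` the states before and after this step, the storage
function `|Σ (ζ - ν)|² + η_k² |ζ + ν|²` grows at a rate of at most `(2 η_k)² |u|² - |C (ζ - ν)|²`.
Coordinates with `η_k = 0` do not contribute to the output. An eigenvector of the reduced matrix on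
the imaginary axis would, by the gap between `η_r` and `η_{r+1}`, lift to one of the stable matrix
`A`. -/

namespace ShiftBT

/-- `x` is the primitive of the locally integrable function `g` on `[0, ∞)` with `x 0 = 0`.
Solutions of differential equations are stated with it, since inputs are only locally integrable. -/
def IsPrimitive {E : Type*} [NormedAddCommGroup E] [NormedSpace ℝ E] (g x : ℝ → E) : Prop :=
  ∀ t, 0 ≤ t → IntervalIntegrable g volume 0 t ∧ x t = ∫ s in (0 : ℝ)..t, g s

namespace IsPrimitive

section Banach

variable {E F : Type*} [NormedAddCommGroup E] [NormedSpace ℝ E] [NormedAddCommGroup F]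
  [NormedSpace ℝ F] {g g' x x' : ℝ → E}

theorem apply_zero (h : IsPrimitive g x) : x 0 = 0 := by
  simpa using (h 0 le_rfl).2

theorem continuousOn (h : IsPrimitive g x) : ContinuousOn x (Set.Ici 0) := by
  have hIcc : ∀ T, 0 ≤ T → ContinuousOn x (Set.Icc 0 T) := fun T hT => by
    have hc := intervalIntegral.continuousOn_primitive_interval' (h T hT).1 Set.left_mem_uIcc
    rw [Set.uIcc_of_le hT] at hc
    exact hc.congr fun t ht => (h t ht.1).2
  intro t ht
  have ht1 : t ∈ Set.Icc 0 (t + 1) := ⟨ht, by linarith⟩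
  refine (hIcc (t + 1) (by linarith [ht1.1]) t ht1).mono_of_mem_nhdsWithin ?_
  exact mem_nhdsWithin.2 ⟨Set.Iio (t + 1), isOpen_Iio, by simp, fun s hs => ⟨hs.2, le_of_lt hs.1⟩⟩

theorem congr (h : IsPrimitive g x) (hg : ∀ t, 0 ≤ t → g' t = g t)
    (hx : ∀ t, 0 ≤ t → x' t = x t) : IsPrimitive g' x' := by
  intro t ht
  have hgt : Set.EqOn g g' (Set.uIcc 0 t) := fun s hs => by
    rw [Set.uIcc_of_le ht] at hs
    exact (hg s hs.1).symm
  refine ⟨(h t ht).1.congr (hgt.mono Set.uIoc_subset_uIcc), ?_⟩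
  rw [hx t ht, (h t ht).2, intervalIntegral.integral_congr hgt]

theorem add (h : IsPrimitive g x) (h' : IsPrimitive g' x') :
    IsPrimitive (fun t => g t + g' t) (fun t => x t + x' t) := fun t ht =>
  ⟨(h t ht).1.add (h' t ht).1, by
    simp only [intervalIntegral.integral_add (h t ht).1 (h' t ht).1, (h t ht).2, (h' t ht).2]⟩

theorem sub (h : IsPrimitive g x) (h' : IsPrimitive g' x') :
    IsPrimitive (fun t => g t - g' t) (fun t => x t - x' t) := fun t ht =>
  ⟨(h t ht).1.sub (h' t ht).1, by
    simp only [intervalIntegral.integral_sub (h t ht).1 (h' t ht).1, (h t ht).2, (h' t ht).2]⟩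

theorem of_hasDerivAt [CompleteSpace E] (hx : ∀ t, HasDerivAt x (g t) t) (hg : Continuous g)
    (h0 : x 0 = 0) : IsPrimitive g x := fun t _ => by
  refine ⟨hg.intervalIntegrable 0 t, ?_⟩
  rw [intervalIntegral.integral_eq_sub_of_hasDerivAt (fun s _ => hx s) (hg.intervalIntegrable 0 t),
    h0, sub_zero]

theorem hasDerivWithinAt [CompleteSpace E] (h : IsPrimitive g x)
    (hg : ContinuousOn g (Set.Ici 0)) {t : ℝ} (ht : 0 ≤ t) :
    HasDerivWithinAt x (g t) (Set.Ici t) t := by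
  have hgt : ContinuousOn g (Set.Ioi t) := hg.mono fun s hs => ht.trans (le_of_lt hs)
  refine HasDerivWithinAt.congr (intervalIntegral.integral_hasDerivWithinAt_right (h t ht).1
    (hgt.stronglyMeasurableAtFilter_nhdsWithin measurableSet_Ioi t)
    ((hg t ht).mono fun s hs => ht.trans (le_of_lt hs))) (fun s hs => (h s (ht.trans hs)).2)
    (h t ht).2

theorem eq_zero_of_linear [CompleteSpace E] {a : E →L[ℝ] E} (h : IsPrimitive (fun s => a (x s)) x)
    {t : ℝ} (ht : 0 ≤ t) : x t = 0 :=
  eq_zero_of_abs_deriv_le_mul_abs_self_of_eq_zero_right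
    (h.continuousOn.mono Set.Icc_subset_Ici_self)
    (fun _ hs => h.hasDerivWithinAt (a.continuous.comp_continuousOn h.continuousOn) hs.1)
    h.apply_zero (fun s _ => a.le_opNorm (x s)) t ⟨ht, le_rfl⟩

theorem clm_comp [CompleteSpace E] [CompleteSpace F] (h : IsPrimitive g x) (f : E →L[ℝ] F) :
    IsPrimitive (fun t => f (g t)) (fun t => f (x t)) := fun t ht =>
  ⟨⟨f.integrable_comp (h t ht).1.1, f.integrable_comp (h t ht).1.2⟩, by
    simp only [(h t ht).2, f.intervalIntegral_comp_comm (h t ht).1]⟩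

end Banach

end IsPrimitive

section LinearEquation

variable {E : Type*} [NormedAddCommGroup E] [NormedSpace ℝ E] [CompleteSpace E]

theorem exists_hasDerivAt_linear_add (a : E →L[ℝ] E) {q : ℝ → E} (hq : Continuous q) :
    ∃ w : ℝ → E, w 0 = 0 ∧ ∀ t, HasDerivAt w (a (w t) + q t) t := by
  let _ : NormedAlgebra ℚ (E →L[ℝ] E) := NormedAlgebra.restrictScalars ℚ ℝ _
  have hexp : ∀ t : ℝ, HasDerivAt (fun t : ℝ => NormedSpace.exp (t • a))
      (a * NormedSpace.exp (t • a)) t := hasDerivAt_exp_smul_const' a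
  have hexpc : Continuous fun t : ℝ => NormedSpace.exp (t • a) :=
    continuous_iff_continuousAt.2 fun t => (hexp t).continuousAt
  have hinv : ∀ t : ℝ, NormedSpace.exp (t • a) * NormedSpace.exp ((-t) • a) = 1 := fun t => by
    rw [← NormedSpace.exp_add_of_commute ((Commute.refl a).smul_left t |>.smul_right (-t)),
      ← add_smul, add_neg_cancel, zero_smul, NormedSpace.exp_zero]
  have hc : Continuous fun s : ℝ => NormedSpace.exp ((-s) • a) (q s) :=
    (hexpc.comp continuous_neg).clm_apply hq
  refine ⟨fun t => NormedSpace.exp (t • a) (∫ s in (0 : ℝ)..t, NormedSpace.exp ((-s) • a) (q s)),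
    by simp, fun t => ?_⟩
  have hqt : NormedSpace.exp (t • a) (NormedSpace.exp ((-t) • a) (q t)) = q t := by
    simpa using congrArg (fun f => f (q t)) (hinv t)
  refine ((hexp t).clm_apply (hc.integral_hasStrictDerivAt 0 t).hasDerivAt).congr_deriv ?_
  rw [hqt]
  rfl

theorem exists_isPrimitive_linear_add (a : E →L[ℝ] E) {g : ℝ → E}
    (hg : ∀ t, 0 ≤ t → IntervalIntegrable g volume 0 t) :
    ∃ x, IsPrimitive (fun s => a (x s) + g s) x := by
  have hp : IsPrimitive g (fun t => ∫ s in (0 : ℝ)..t, g s) := fun t ht => ⟨hg t ht, rfl⟩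
  set p : ℝ → E := fun t => ∫ s in (0 : ℝ)..t, g s
  have hpc : Continuous fun t => a (p (max 0 t)) := a.continuous.comp
    (hp.continuousOn.comp_continuous (by fun_prop) fun t => le_max_left 0 t)
  obtain ⟨w, hw0, hw⟩ := exists_hasDerivAt_linear_add a hpc
  have hwc : Continuous w := continuous_iff_continuousAt.2 fun t => (hw t).continuousAt
  have hwp := IsPrimitive.of_hasDerivAt hw ((a.continuous.comp hwc).add hpc) hw0
  refine ⟨fun t => w t + p t, (hwp.add hp).congr (fun t ht => ?_) fun t _ => rfl⟩
  simp only [map_add, max_eq_right ht]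

end LinearEquation

section DotProduct

variable {ν κ : Type*} [Fintype ν] [Fintype κ]

theorem IsPrimitive.mulVec {g x : ℝ → ν → ℝ} (h : IsPrimitive g x) (M : Matrix κ ν ℝ) :
    IsPrimitive (fun t => M *ᵥ g t) (fun t => M *ᵥ x t) :=
  h.clm_comp (LinearMap.toContinuousLinearMap M.mulVecLin)

theorem IsPrimitive.apply {g x : ℝ → ν → ℝ} (h : IsPrimitive g x) (i : ν) :
    IsPrimitive (fun t => g t i) (fun t => x t i) :=
  h.clm_comp (ContinuousLinearMap.proj i)

theorem IsPrimitive.mul_self_eq_integral {f F : ℝ → ℝ} (hF : IsPrimitive f F) {T : ℝ}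
    (hT : 0 ≤ T) : F T * F T = ∫ s in (0 : ℝ)..T, 2 * (F s * f s) := by
  have hf := (hF T hT).1
  have hac := hf.absolutelyContinuousOnInterval_intervalIntegral Set.left_mem_uIcc
  have hparts := hac.integral_deriv_mul_eq_sub hac
  simp only [intervalIntegral.integral_same, mul_zero, sub_zero] at hparts
  rw [(hF T hT).2, ← hparts]
  refine intervalIntegral.integral_congr_ae ?_
  filter_upwards [hf.ae_hasDerivAt_integral] with t hderiv ht
  have ht' : t ∈ Set.uIcc 0 T := Set.uIoc_subset_uIcc ht
  have ht0 : 0 ≤ t := by rw [Set.uIcc_of_le hT] at ht'; exact ht'.1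
  rw [(hderiv ht' 0 Set.left_mem_uIcc).deriv, (hF t ht0).2]
  ring

theorem IsPrimitive.intervalIntegrable_mul {f F : ℝ → ℝ} (hF : IsPrimitive f F) {T : ℝ}
    (hT : 0 ≤ T) : IntervalIntegrable (fun t => F t * f t) volume 0 T := by
  refine (hF T hT).1.continuousOn_mul (hF.continuousOn.mono ?_)
  rw [Set.uIcc_of_le hT]
  exact Set.Icc_subset_Ici_self

theorem IsPrimitive.intervalIntegrable_dotProduct {g x : ℝ → ν → ℝ} (h : IsPrimitive g x) {T : ℝ}
    (hT : 0 ≤ T) : IntervalIntegrable (fun t => x t ⬝ᵥ g t) volume 0 T := by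
  have hsum : (fun t => x t ⬝ᵥ g t) = ∑ i, fun t => x t i * g t i := by
    ext t
    simp only [dotProduct, Finset.sum_apply]
  rw [hsum]
  exact IntervalIntegrable.sum _ fun i _ => (h.apply i).intervalIntegrable_mul hT

theorem IsPrimitive.integral_dotProduct_nonneg {g x : ℝ → ν → ℝ} (h : IsPrimitive g x) {T : ℝ}
    (hT : 0 ≤ T) : 0 ≤ ∫ s in (0 : ℝ)..T, x s ⬝ᵥ g s := by
  simp only [dotProduct]
  rw [intervalIntegral.integral_finsetSum fun i _ => (h.apply i).intervalIntegrable_mul hT]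
  refine Finset.sum_nonneg fun i _ => ?_
  have hi := (h.apply i).mul_self_eq_integral hT
  rw [intervalIntegral.integral_const_mul] at hi
  linarith [mul_self_nonneg (x T i)]

end DotProduct

section L2

variable {κ : Type*} [Fintype κ] {m : Measure ℝ} {f g : ℝ → κ → ℝ}

/-- The `L²` norm of a vector signal with respect to a measure on the time axis; `normL2` is the
case of Lebesgue measure on `[0, ∞)`, and finite horizons are restrictions to `(0, T]`. -/
noncomputable def l2Norm (m : Measure ℝ) (g : ℝ → κ → ℝ) : ℝ :=
  √(∫ t, g t ⬝ᵥ g t ∂m)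

/-- Square integrability of a vector signal on bounded time intervals. -/
def IsLocallyL2 (u : ℝ → κ → ℝ) : Prop :=
  ∀ T, 0 ≤ T → MemLp (fun t => WithLp.toLp 2 (u t)) 2 (volume.restrict (Set.Ioc 0 T))

theorem norm_toLp_sq (v : κ → ℝ) : ‖WithLp.toLp 2 v‖ ^ 2 = v ⬝ᵥ v := by
  simp only [PiLp.norm_sq_eq_of_L2, Real.norm_eq_abs, sq_abs, dotProduct, ← sq]

theorem real_dotProduct_self_nonneg (v : κ → ℝ) : 0 ≤ v ⬝ᵥ v := by
  rw [← norm_toLp_sq]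
  positivity

omit [Fintype κ] in
theorem aestronglyMeasurable_toLp_iff :
    AEStronglyMeasurable (fun t => WithLp.toLp 2 (g t)) m ↔ AEStronglyMeasurable g m :=
  ⟨fun h => (PiLp.continuous_ofLp 2 fun _ : κ => ℝ).comp_aestronglyMeasurable h,
    fun h => (PiLp.continuous_toLp 2 fun _ : κ => ℝ).comp_aestronglyMeasurable h⟩

theorem memLp_toLp_iff : MemLp (fun t => WithLp.toLp 2 (g t)) 2 m ↔
    AEStronglyMeasurable g m ∧ Integrable (fun t => g t ⬝ᵥ g t) m := by
  rw [← aestronglyMeasurable_toLp_iff]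
  simp only [← norm_toLp_sq]
  exact ⟨fun h => ⟨h.1, (memLp_two_iff_integrable_sq_norm h.1).1 h⟩,
    fun h => (memLp_two_iff_integrable_sq_norm h.1).2 h.2⟩

theorem l2Norm_eq_lpNorm (hg : AEStronglyMeasurable g m) :
    l2Norm m g = lpNorm (fun t => WithLp.toLp 2 (g t)) 2 m := by
  rw [l2Norm, lpNorm_eq_integral_norm_rpow_toReal (by simp) (by simp)
    (aestronglyMeasurable_toLp_iff.2 hg), Real.sqrt_eq_rpow]
  simp [← norm_toLp_sq]

theorem l2Norm_nonneg : 0 ≤ l2Norm m g :=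
  Real.sqrt_nonneg _

theorem l2Norm_sq : l2Norm m g ^ 2 = ∫ t, g t ⬝ᵥ g t ∂m :=
  Real.sq_sqrt (integral_nonneg fun t => real_dotProduct_self_nonneg (g t))

theorem l2Norm_add_le (hf : MemLp (fun t => WithLp.toLp 2 (f t)) 2 m)
    (hg : AEStronglyMeasurable g m) :
    l2Norm m (fun t => f t + g t) ≤ l2Norm m f + l2Norm m g := by
  have hfm := aestronglyMeasurable_toLp_iff.1 hf.1
  rw [l2Norm_eq_lpNorm hfm, l2Norm_eq_lpNorm hg,
    l2Norm_eq_lpNorm (g := fun t => f t + g t) (hfm.add hg)]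
  exact lpNorm_add_le hf (by norm_num)

theorem l2Norm_restrict_congr {s : Set ℝ} (hs : MeasurableSet s) (h : Set.EqOn f g s) :
    l2Norm (m.restrict s) f = l2Norm (m.restrict s) g := by
  rw [l2Norm, l2Norm, setIntegral_congr_fun hs fun t ht => by rw [h ht]]

theorem l2Norm_mono_measure {m' : Measure ℝ} (hm : m ≤ m')
    (hg : Integrable (fun t => g t ⬝ᵥ g t) m') : l2Norm m g ≤ l2Norm m' g :=
  Real.sqrt_le_sqrt (integral_mono_measure hm
    (Filter.Eventually.of_forall fun t => real_dotProduct_self_nonneg (g t)) hg)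

theorem isLocallyL2_of_continuousOn (hg : ContinuousOn g (Set.Ici 0)) : IsLocallyL2 g := by
  intro T _
  have hIcc : ContinuousOn g (Set.Icc 0 T) := hg.mono Set.Icc_subset_Ici_self
  refine memLp_toLp_iff.2 ⟨(hIcc.mono Set.Ioc_subset_Icc_self).aestronglyMeasurable
    measurableSet_Ioc, ?_⟩
  have hdot : ContinuousOn (fun t => g t ⬝ᵥ g t) (Set.Icc 0 T) := by
    simp only [dotProduct]
    exact continuousOn_finsetSum _ fun i _ =>
      (continuousOn_pi.1 hIcc i).mul (continuousOn_pi.1 hIcc i)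
  exact hdot.integrableOn_Icc.mono_set Set.Ioc_subset_Icc_self

theorem IsPrimitive.isLocallyL2_mulVec {ν : Type*} [Fintype ν] {a x : ℝ → ν → ℝ}
    (hx : IsPrimitive a x) (M : Matrix κ ν ℝ) : IsLocallyL2 (fun t => M *ᵥ x t) :=
  isLocallyL2_of_continuousOn (hx.mulVec M).continuousOn

theorem IsLocallyL2.intervalIntegrable_dotProduct (hg : IsLocallyL2 g) {T : ℝ} (hT : 0 ≤ T) :
    IntervalIntegrable (fun t => g t ⬝ᵥ g t) volume 0 T :=
  (intervalIntegrable_iff_integrableOn_Ioc_of_le hT).2 (memLp_toLp_iff.1 (hg T hT)).2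

theorem IsLocallyL2.intervalIntegrable (hg : IsLocallyL2 g) {T : ℝ} (hT : 0 ≤ T) :
    IntervalIntegrable g volume 0 T := by
  have h1 := ((hg T hT).integrable (by norm_num))
  rw [intervalIntegrable_iff_integrableOn_Ioc_of_le hT]
  exact (PiLp.continuousLinearEquiv 2 ℝ fun _ : κ => ℝ).toContinuousLinearMap.integrable_comp h1

theorem l2Norm_le_of_integral_le {ι : Type*} [Fintype ι] {u : ℝ → ι → ℝ} {c T : ℝ} (hT : 0 ≤ T)
    (hc : 0 ≤ c) (h : ∫ t in (0 : ℝ)..T, g t ⬝ᵥ g t ≤ c ^ 2 * ∫ t in (0 : ℝ)..T, u t ⬝ᵥ u t) :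
    l2Norm (volume.restrict (Set.Ioc 0 T)) g ≤ c * l2Norm (volume.restrict (Set.Ioc 0 T)) u := by
  rw [intervalIntegral.integral_of_le hT, intervalIntegral.integral_of_le hT, ← l2Norm_sq,
    ← l2Norm_sq, ← mul_pow] at h
  exact le_of_sq_le_sq h (mul_nonneg hc l2Norm_nonneg)

theorem integrableOn_and_l2Norm_le_of_forall_le (hg : IsLocallyL2 g) {c : ℝ} (hc : 0 ≤ c)
    (hb : ∀ T, 0 ≤ T → l2Norm (volume.restrict (Set.Ioc 0 T)) g ≤ c) :
    IntegrableOn (fun t => g t ⬝ᵥ g t) (Set.Ici 0) ∧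
      l2Norm (volume.restrict (Set.Ici 0)) g ≤ c := by
  have hbT : ∀ T, 0 ≤ T → ∫ t in (0 : ℝ)..T, g t ⬝ᵥ g t ≤ c ^ 2 := fun T hT => by
    rw [intervalIntegral.integral_of_le hT, ← l2Norm_sq]
    exact pow_le_pow_left₀ l2Norm_nonneg (hb T hT) 2
  have hev := Filter.eventually_ge_atTop (0 : ℝ)
  have hI : IntegrableOn (fun t => g t ⬝ᵥ g t) (Set.Ioi 0) := by
    refine integrableOn_Ioi_of_intervalIntegral_norm_bounded (l := Filter.atTop)
      (b := fun T : ℝ => max 0 T) (c ^ 2) 0 (fun T => ?_)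
      (Filter.tendsto_atTop_mono (fun T => le_max_right 0 T) Filter.tendsto_id) ?_
    · exact (memLp_toLp_iff.1 (hg _ (le_max_left 0 T))).2
    · simp only [Real.norm_of_nonneg (real_dotProduct_self_nonneg _)]
      exact Filter.Eventually.of_forall fun T => hbT _ (le_max_left 0 T)
  refine ⟨(integrableOn_Ici_iff_integrableOn_Ioi (by simp)).2 hI, (Real.sqrt_le_left hc).2 ?_⟩
  rw [integral_Ici_eq_integral_Ioi]
  exact le_of_tendsto (intervalIntegral_tendsto_integral_Ioi 0 hI Filter.tendsto_id)
    (hev.mono hbT)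

end L2

section ZeroTrajectory

variable {ν κ ι : Type*} [Fintype ν] [Fintype κ] [Fintype ι]

/-- `x` is the solution of `ẋ = A x + B u`, `x 0 = 0`, for arbitrary finite index types. -/
def IsZeroTrajectory (A : Matrix ν ν ℝ) (B : Matrix ν ι ℝ) (u : ℝ → ι → ℝ) (x : ℝ → ν → ℝ) :
    Prop :=
  IsPrimitive (fun s => A *ᵥ x s + B *ᵥ u s) x

variable {A : Matrix ν ν ℝ} {B : Matrix ν ι ℝ} {u : ℝ → ι → ℝ} {x x' : ℝ → ν → ℝ}

theorem exists_isZeroTrajectory (A : Matrix ν ν ℝ) (B : Matrix ν ι ℝ)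
    (hu : ∀ t, 0 ≤ t → IntervalIntegrable u volume 0 t) : ∃ x, IsZeroTrajectory A B u x := by
  have hBu : ∀ t, 0 ≤ t → IntervalIntegrable (fun s => B *ᵥ u s) volume 0 t := fun t ht =>
    have hI : IsPrimitive u (fun t => ∫ s in (0 : ℝ)..t, u s) := fun t ht => ⟨hu t ht, rfl⟩
    ((hI.mulVec B) t ht).1
  exact exists_isPrimitive_linear_add (LinearMap.toContinuousLinearMap A.mulVecLin) hBu

theorem IsZeroTrajectory.unique (hx : IsZeroTrajectory A B u x) (hx' : IsZeroTrajectory A B u x')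
    {t : ℝ} (ht : 0 ≤ t) : x t = x' t := by
  have hdiff : IsPrimitive
      (fun s => LinearMap.toContinuousLinearMap A.mulVecLin (x s - x' s)) (fun s => x s - x' s) :=
    (IsPrimitive.sub hx hx').congr (fun s _ => by simp [mulVec_sub]) fun _ _ => rfl
  exact sub_eq_zero.1 (hdiff.eq_zero_of_linear ht)

theorem IsZeroTrajectory.mulVec (hx : IsZeroTrajectory A B u x) {M : Matrix κ ν ℝ}
    {A' : Matrix κ κ ℝ} {B' : Matrix κ ι ℝ} (hA : A' * M = M * A) (hB : B' = M * B) :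
    IsZeroTrajectory A' B' u (fun t => M *ᵥ x t) :=
  (IsPrimitive.mulVec hx M).congr
    (fun s _ => by simp only [hB, mulVec_add, mulVec_mulVec, hA]) fun _ _ => rfl

end ZeroTrajectory

section Lyapunov

variable {ν κ : Type*} [Fintype ν] [Fintype κ]

theorem two_mul_dotProduct_of_lyapunov {A S : Matrix ν ν ℝ} {C : Matrix κ ν ℝ} (hS : Sᵀ = S)
    (h : Aᵀ * S + S * A + Cᵀ * C = 0) (z : ν → ℝ) :
    2 * (S *ᵥ z ⬝ᵥ A *ᵥ z) = -(C *ᵥ z ⬝ᵥ C *ᵥ z) := by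
  have hz : z ⬝ᵥ (Aᵀ * S + S * A + Cᵀ * C) *ᵥ z = 0 := by rw [h, zero_mulVec, dotProduct_zero]
  simp only [add_mulVec, dotProduct_add, ← mulVec_mulVec, dotProduct_transpose_mulVec] at hz
  have hSz : z ⬝ᵥ S *ᵥ (A *ᵥ z) = S *ᵥ z ⬝ᵥ A *ᵥ z := by
    rw [dotProduct_comm (S *ᵥ z), ← dotProduct_transpose_mulVec, hS]
  rw [hSz] at hz
  linarith

end Lyapunov

section Truncation

variable {μ ι o : Type*} [Fintype μ] [DecidableEq μ] [Fintype ι] [Fintype o] {η : μ → ℝ}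
  {A : Matrix μ μ ℝ} {B : Matrix μ ι ℝ} {C : Matrix o μ ℝ} {u : ℝ → ι → ℝ}

/-- The descriptor system `diag(η) ζ' = A ζ + B u`, `y = C ζ` is balanced. If `Lᵀ R = diag(η)` for
factors `R`, `L` of the Gramians of a system, then these are the equations satisfied by `ζ` along
the states `R ζ`; the entries of `η` may vanish, so they cannot be divided out. -/
structure IsBalanced (η : μ → ℝ) (A : Matrix μ μ ℝ) (B : Matrix μ ι ℝ) (C : Matrix o μ ℝ) :
    Prop where
  ctr : A * diagonal η + diagonal η * Aᵀ + B * Bᵀ = 0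
  obs : Aᵀ * diagonal η + diagonal η * A + Cᵀ * C = 0

/-- The inverse of `diag(η)` on the coordinates in `s`, and zero on the other ones. -/
noncomputable def truncInv (η : μ → ℝ) (s : Finset μ) : Matrix μ μ ℝ :=
  diagonal fun i => if i ∈ s then (η i)⁻¹ else 0

/-- `ζ` solves the truncation of `diag(η) ζ' = A ζ + B u`, `ζ 0 = 0` to the coordinates in `s`. All
truncations live in the same space, the coordinates outside `s` being zero. -/
def IsTruncatedTrajectory (η : μ → ℝ) (s : Finset μ) (A : Matrix μ μ ℝ) (B : Matrix μ ι ℝ)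
    (u : ℝ → ι → ℝ) (ζ : ℝ → μ → ℝ) : Prop :=
  IsZeroTrajectory (truncInv η s * A) (truncInv η s * B) u ζ

theorem truncInv_mulVec (η : μ → ℝ) (s : Finset μ) (v : μ → ℝ) :
    truncInv η s *ᵥ v = fun i => if i ∈ s then (η i)⁻¹ * v i else 0 := by
  ext i
  rw [truncInv, mulVec_diagonal, ite_mul, zero_mul]

theorem IsTruncatedTrajectory.isPrimitive {s : Finset μ} {ζ : ℝ → μ → ℝ}
    (h : IsTruncatedTrajectory η s A B u ζ) :
    IsPrimitive (fun t => truncInv η s *ᵥ (A *ᵥ ζ t + B *ᵥ u t)) ζ :=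
  IsPrimitive.congr h (fun t _ => by simp only [mulVec_add, mulVec_mulVec]) fun _ _ => rfl

theorem IsTruncatedTrajectory.apply_eq_zero {s : Finset μ} {ζ : ℝ → μ → ℝ}
    (h : IsTruncatedTrajectory η s A B u ζ) {t : ℝ} (ht : 0 ≤ t) {i : μ} (hi : i ∉ s) :
    ζ t i = 0 := by
  simpa only [truncInv_mulVec, hi, if_false, intervalIntegral.integral_zero] using
    (h.isPrimitive.apply i t ht).2

theorem diagonal_mulVec_truncInv_mulVec {s : Finset μ} {v : μ → ℝ} (hη : ∀ i ∈ s, η i ≠ 0)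
    (hv : ∀ i ∉ s, v i = 0) : diagonal η *ᵥ (truncInv η s *ᵥ v) = v := by
  ext i
  rw [truncInv_mulVec, mulVec_diagonal]
  by_cases hi : i ∈ s
  · simp [hi, hη i hi]
  · simp [hi, hv i hi]

-- With `Σ = diag(η)`, the left-hand side is half the derivative of the storage function
-- `|Σ (ζ - ν)|² + η_k² |ζ + ν|²` along `ζ' = truncInv η (insert k s) p`, `ν' = truncInv η s q`. The
-- weight `η_k²` makes the contributions of `q k` to the two squares cancel.
theorem truncInv_insert_weighted_sum {s : Finset μ} {k : μ} (hk : k ∉ s)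
    (hη : ∀ i ∈ insert k s, η i ≠ 0) {ζ ν : μ → ℝ} (hζ : ∀ i ∉ insert k s, ζ i = 0)
    (hν : ∀ i ∉ s, ν i = 0) (p q : μ → ℝ) :
    diagonal η *ᵥ (ζ - ν) ⬝ᵥ diagonal η *ᵥ (truncInv η (insert k s) *ᵥ p - truncInv η s *ᵥ q)
        + η k ^ 2 * ((ζ + ν) ⬝ᵥ (truncInv η (insert k s) *ᵥ p + truncInv η s *ᵥ q))
      = diagonal η *ᵥ (ζ - ν) ⬝ᵥ (p - q)
        + η k ^ 2 * (truncInv η (insert k s) *ᵥ (ζ + ν) ⬝ᵥ (p + q)) := by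
  simp only [dotProduct, Finset.mul_sum, ← Finset.sum_add_distrib]
  refine Finset.sum_congr rfl fun i _ => ?_
  simp only [truncInv_mulVec, mulVec_diagonal, Pi.sub_apply, Pi.add_apply, Finset.mem_insert]
  rcases eq_or_ne i k with rfl | hik
  · have hi := hη i (Finset.mem_insert_self i s)
    simp only [hk, hν i hk, true_or, if_true, if_false]
    field_simp
    ring
  by_cases his : i ∈ s
  · have hi := hη i (Finset.mem_insert_of_mem his)
    simp only [hik, his, or_true, if_true]
    field_simp
  · simp only [hik, his, hν i his, hζ i (by simp [hik, his]), or_self, if_false]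
    ring

theorem IsBalanced.dissipation_insert (h : IsBalanced η A B C) {s : Finset μ} {k : μ} (hk : k ∉ s)
    (hη : ∀ i ∈ insert k s, η i ≠ 0) {ζ ν : μ → ℝ} (hζ : ∀ i ∉ insert k s, ζ i = 0)
    (hν : ∀ i ∉ s, ν i = 0) (v : ι → ℝ) :
    2 * (diagonal η *ᵥ (ζ - ν) ⬝ᵥ diagonal η *ᵥ (truncInv η (insert k s) *ᵥ (A *ᵥ ζ + B *ᵥ v)
        - truncInv η s *ᵥ (A *ᵥ ν + B *ᵥ v))
      + η k ^ 2 * ((ζ + ν) ⬝ᵥ (truncInv η (insert k s) *ᵥ (A *ᵥ ζ + B *ᵥ v)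
        + truncInv η s *ᵥ (A *ᵥ ν + B *ᵥ v))))
      ≤ (2 * η k) ^ 2 * (v ⬝ᵥ v) - C *ᵥ (ζ - ν) ⬝ᵥ C *ᵥ (ζ - ν) := by
  rw [truncInv_insert_weighted_sum hk hη hζ hν]
  have hsupp : ∀ i ∉ insert k s, (ζ + ν) i = 0 := fun i hi => by
    rw [Pi.add_apply, hζ i hi, hν i fun his => hi (Finset.mem_insert_of_mem his), add_zero]
  set m := truncInv η (insert k s) *ᵥ (ζ + ν)
  have hm : diagonal η *ᵥ m = ζ + ν := diagonal_mulVec_truncInv_mulVec hη hsupp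
  have hobs := two_mul_dotProduct_of_lyapunov (diagonal_transpose η) h.obs (ζ - ν)
  have hctr : 2 * (m ⬝ᵥ A *ᵥ (ζ + ν)) = -(Bᵀ *ᵥ m ⬝ᵥ Bᵀ *ᵥ m) := by
    rw [← two_mul_dotProduct_of_lyapunov (A := Aᵀ) (diagonal_transpose η)
      (by simpa only [transpose_transpose] using h.ctr), hm, dotProduct_transpose_mulVec]
  have hdiff : A *ᵥ ζ + B *ᵥ v - (A *ᵥ ν + B *ᵥ v) = A *ᵥ (ζ - ν) := by
    rw [mulVec_sub, add_sub_add_right_eq_sub]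
  have hsum : A *ᵥ ζ + B *ᵥ v + (A *ᵥ ν + B *ᵥ v) = A *ᵥ (ζ + ν) + (2 : ℝ) • B *ᵥ v := by
    rw [mulVec_add, add_add_add_comm, two_smul]
  have hin : m ⬝ᵥ B *ᵥ v = Bᵀ *ᵥ m ⬝ᵥ v := by
    rw [dotProduct_mulVec, ← mulVec_transpose]
  have hsq := real_dotProduct_self_nonneg (Bᵀ *ᵥ m - (2 : ℝ) • v)
  simp only [sub_dotProduct, dotProduct_sub, smul_dotProduct, dotProduct_smul, smul_eq_mul,
    dotProduct_comm v] at hsq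
  rw [hdiff, hsum, dotProduct_add, dotProduct_smul, hin, smul_eq_mul]
  nlinarith [mul_le_mul_of_nonneg_left hsq (sq_nonneg (η k))]

theorem IsBalanced.l2Norm_sub_le_of_insert (h : IsBalanced η A B C) {s : Finset μ} {k : μ}
    (hk : k ∉ s) (hη : ∀ i ∈ insert k s, 0 < η i) {ζ ν : ℝ → μ → ℝ}
    (hζ : IsTruncatedTrajectory η (insert k s) A B u ζ)
    (hν : IsTruncatedTrajectory η s A B u ν) (hu : IsLocallyL2 u) {T : ℝ} (hT : 0 ≤ T) :
    l2Norm (volume.restrict (Set.Ioc 0 T)) (fun t => C *ᵥ (ζ t - ν t))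
      ≤ 2 * η k * l2Norm (volume.restrict (Set.Ioc 0 T)) u := by
  have hdiff := (hζ.isPrimitive.sub hν.isPrimitive).mulVec (diagonal η)
  have hsum := hζ.isPrimitive.add hν.isPrimitive
  have hout := ((hζ.isPrimitive.sub hν.isPrimitive).isLocallyL2_mulVec
    C).intervalIntegrable_dotProduct hT
  have hdiffI := hdiff.intervalIntegrable_dotProduct hT
  have hsumI := (hsum.intervalIntegrable_dotProduct hT).const_mul (η k ^ 2)
  have huI := (hu.intervalIntegrable_dotProduct hT).const_mul ((2 * η k) ^ 2)
  refine l2Norm_le_of_integral_le hT (by linarith [hη k (Finset.mem_insert_self k s)]) ?_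
  have hmono := intervalIntegral.integral_mono_on hT ((hdiffI.add hsumI).const_mul 2)
    (huI.sub hout) fun t ht => h.dissipation_insert hk (fun i hi => (hη i hi).ne')
      (fun i hi => hζ.apply_eq_zero ht.1 hi) (fun i hi => hν.apply_eq_zero ht.1 hi) (u t)
  rw [intervalIntegral.integral_const_mul, intervalIntegral.integral_add hdiffI hsumI,
    intervalIntegral.integral_sub huI hout, intervalIntegral.integral_const_mul,
    intervalIntegral.integral_const_mul] at hmono
  nlinarith [hdiff.integral_dotProduct_nonneg hT,
    mul_nonneg (sq_nonneg (η k)) (hsum.integral_dotProduct_nonneg hT)]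

theorem IsBalanced.l2Norm_sub_le_of_union (h : IsBalanced η A B C) {K t : Finset μ}
    (hKt : Disjoint K t) (hη : ∀ i ∈ K ∪ t, 0 < η i) {ζ ν : ℝ → μ → ℝ}
    (hζ : IsTruncatedTrajectory η (K ∪ t) A B u ζ) (hν : IsTruncatedTrajectory η K A B u ν)
    (hu : IsLocallyL2 u) {T : ℝ} (hT : 0 ≤ T) :
    l2Norm (volume.restrict (Set.Ioc 0 T)) (fun t => C *ᵥ (ζ t - ν t))
      ≤ 2 * (∑ i ∈ t, η i) * l2Norm (volume.restrict (Set.Ioc 0 T)) u := by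
  induction t using Finset.induction_on generalizing ζ with
  | empty =>
    rw [Finset.union_empty] at hζ
    have hzero : Set.EqOn (fun t => C *ᵥ (ζ t - ν t)) (fun _ => 0) (Set.Ioc 0 T) := fun t ht => by
      simp only [IsZeroTrajectory.unique hζ hν ht.1.le, sub_self, mulVec_zero]
    rw [l2Norm_restrict_congr measurableSet_Ioc hzero]
    simp [l2Norm]
  | insert k t hkt ih =>
    rw [Finset.disjoint_insert_right] at hKt
    rw [Finset.union_insert] at hζ hη
    have hk : k ∉ K ∪ t := by simp [hKt.1, hkt]
    obtain ⟨ξ, hξ⟩ : ∃ ξ, IsTruncatedTrajectory η (K ∪ t) A B u ξ :=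
      exists_isZeroTrajectory _ _ fun T hT => hu.intervalIntegrable hT
    have hstep := h.l2Norm_sub_le_of_insert hk hη hζ hξ hu hT
    have htail := ih hKt.2 (fun i hi => hη i (Finset.mem_insert_of_mem hi)) hξ
    have hsplit : (fun t => C *ᵥ (ζ t - ν t))
        = fun t => C *ᵥ (ζ t - ξ t) + C *ᵥ (ξ t - ν t) := by
      simp only [← mulVec_add, sub_add_sub_cancel]
    have hζξ := (hζ.isPrimitive.sub hξ.isPrimitive).isLocallyL2_mulVec C T hT
    have hξν := (hξ.isPrimitive.sub hν.isPrimitive).isLocallyL2_mulVec C T hT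
    rw [hsplit, Finset.sum_insert hkt, mul_add, add_mul]
    exact (l2Norm_add_le hζξ (memLp_toLp_iff.1 hξν).1).trans (add_le_add hstep htail)

end Truncation

section Balancing

variable {ν μ ι o κ : Type*} [Fintype ν] [Fintype μ] [DecidableEq μ] [Fintype ι] [Fintype o]
  {A : Matrix ν ν ℝ} {B : Matrix ν ι ℝ} {C : Matrix o ν ℝ} {R L : Matrix ν μ ℝ} {η : μ → ℝ}
  {u : ℝ → ι → ℝ} {x : ℝ → ν → ℝ}

/-- `R Rᵀ` and `L Lᵀ` are Gramians of `[A, B, C]` whose factors are balanced with Hankel singular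
values `η`. The orthogonal matrices of a singular value decomposition `Lᵀ R = U diag(η) Zᵀ` are
absorbed into the factors `R Z` and `L U`. -/
structure IsBalancing (A : Matrix ν ν ℝ) (B : Matrix ν ι ℝ) (C : Matrix o ν ℝ) (R L : Matrix ν μ ℝ)
    (η : μ → ℝ) : Prop where
  ctr : A * (R * Rᵀ) + R * Rᵀ * Aᵀ + B * Bᵀ = 0
  obs : Aᵀ * (L * Lᵀ) + L * Lᵀ * A + Cᵀ * C = 0
  balanced : Lᵀ * R = diagonal η

theorem IsBalancing.transpose_mul (h : IsBalancing A B C R L η) : Rᵀ * L = diagonal η := by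
  rw [← transpose_transpose L, ← Matrix.transpose_mul, h.balanced, diagonal_transpose]

theorem IsBalancing.isBalanced (h : IsBalancing A B C R L η) :
    IsBalanced η (Lᵀ * A * R) (Lᵀ * B) (C * R) where
  ctr := by
    have hL : Lᵀ * (A * (R * Rᵀ) + R * Rᵀ * Aᵀ + B * Bᵀ) * L = 0 := by simp [h.ctr]
    rw [← hL]
    nth_rewrite 1 [← h.transpose_mul]
    rw [← h.balanced]
    simp only [Matrix.transpose_mul, transpose_transpose, Matrix.mul_add, Matrix.add_mul,
      Matrix.mul_assoc]
  obs := by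
    have hR : Rᵀ * (Aᵀ * (L * Lᵀ) + L * Lᵀ * A + Cᵀ * C) * R = 0 := by simp [h.obs]
    rw [← hR]
    nth_rewrite 1 [← h.balanced]
    rw [← h.transpose_mul]
    simp only [Matrix.transpose_mul, transpose_transpose, Matrix.mul_add, Matrix.add_mul,
      Matrix.mul_assoc]

omit [DecidableEq μ] in
theorem exists_eq_mul_of_forall_mulVec_eq_zero {K : Type*} [Field K] {M : Matrix ν μ K}
    {N : Matrix ν κ K} (h : ∀ v, Mᵀ *ᵥ v = 0 → Nᵀ *ᵥ v = 0) : ∃ X : Matrix μ κ K, N = M * X := by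
  classical
  have hker : LinearMap.ker Mᵀ.mulVecLin ≤ LinearMap.ker Nᵀ.mulVecLin := h
  obtain ⟨g, hg⟩ := LinearMap.exists_extend
    ((LinearMap.ker Mᵀ.mulVecLin).liftQ Nᵀ.mulVecLin hker ∘ₗ
      Mᵀ.mulVecLin.quotKerEquivRange.symm.toLinearMap)
  have hgM : ∀ v, g (Mᵀ *ᵥ v) = Nᵀ *ᵥ v := fun v => by
    exact (LinearMap.congr_fun hg ⟨_, LinearMap.mem_range_self _ v⟩).trans <|
      congrArg ((LinearMap.ker Mᵀ.mulVecLin).liftQ _ hker)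
        (LinearMap.quotKerEquivRange_symm_apply_image Mᵀ.mulVecLin v _)
  refine ⟨(LinearMap.toMatrix' g)ᵀ, transpose_injective (ext_of_mulVec_single fun i => ?_)⟩
  rw [Matrix.transpose_mul, transpose_transpose, ← mulVec_mulVec, LinearMap.toMatrix'_mulVec, hgM]

omit [DecidableEq μ] in
theorem forall_mulVec_eq_zero_of_ctr (h : A * (R * Rᵀ) + R * Rᵀ * Aᵀ + B * Bᵀ = 0) {v : ν → ℝ}
    (hv : Rᵀ *ᵥ v = 0) : Bᵀ *ᵥ v = 0 ∧ Rᵀ *ᵥ (Aᵀ *ᵥ v) = 0 := by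
  have hv' : v ᵥ* R = 0 := by rw [← mulVec_transpose, hv]
  have hBv : Bᵀ *ᵥ v = 0 := by
    have hz : v ⬝ᵥ (A * (R * Rᵀ) + R * Rᵀ * Aᵀ + B * Bᵀ) *ᵥ v = 0 := by simp [h]
    simp only [add_mulVec, dotProduct_add, ← mulVec_mulVec, hv, mulVec_zero, dotProduct_mulVec _ R,
      hv', zero_dotProduct, zero_add] at hz
    rw [dotProduct_mulVec, ← mulVec_transpose] at hz
    exact dotProduct_self_eq_zero.1 hz
  have hz : (A * (R * Rᵀ) + R * Rᵀ * Aᵀ + B * Bᵀ) *ᵥ v = 0 := by simp [h]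
  simp only [add_mulVec, ← mulVec_mulVec, hv, hBv, mulVec_zero, zero_add, add_zero] at hz
  refine ⟨hBv, dotProduct_self_eq_zero.1 ?_⟩
  rw [dotProduct_transpose_mulVec, hz, dotProduct_zero]

omit [DecidableEq μ] in
theorem IsZeroTrajectory.exists_eq_mulVec (hx : IsZeroTrajectory A B u x)
    (h : A * (R * Rᵀ) + R * Rᵀ * Aᵀ + B * Bᵀ = 0)
    (hu : ∀ t, 0 ≤ t → IntervalIntegrable u volume 0 t) :
    ∃ ξ : ℝ → μ → ℝ, ∀ t, 0 ≤ t → x t = R *ᵥ ξ t := by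
  obtain ⟨A', hA'⟩ : ∃ A', A * R = R * A' := exists_eq_mul_of_forall_mulVec_eq_zero fun v hv => by
    rw [Matrix.transpose_mul, ← mulVec_mulVec, (forall_mulVec_eq_zero_of_ctr h hv).2]
  obtain ⟨B', hB'⟩ : ∃ B', B = R * B' := exists_eq_mul_of_forall_mulVec_eq_zero fun v hv =>
    (forall_mulVec_eq_zero_of_ctr h hv).1
  obtain ⟨ξ, hξ⟩ := exists_isZeroTrajectory A' B' hu
  exact ⟨ξ, fun t ht => hx.unique (hξ.mulVec hA' hB') ht⟩

theorem dotProduct_diagonal_mulVec_truncInv_mulVec {s : Finset μ} {v : μ → ℝ}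
    (hη : ∀ i ∈ s, η i ≠ 0) (hv : ∀ i ∉ s, v i = 0) (w : μ → ℝ) :
    v ⬝ᵥ diagonal η *ᵥ (truncInv η s *ᵥ w) = v ⬝ᵥ w := by
  refine Finset.sum_congr rfl fun i _ => ?_
  rw [truncInv_mulVec, mulVec_diagonal]
  by_cases hi : i ∈ s
  · simp [hi, hη i hi]
  · simp [hv i hi]

theorem IsBalancing.dissipation_minimal (h : IsBalancing A B C R L η) {s : Finset μ}
    (hs : ∀ i ∈ s, η i ≠ 0) {x : ν → ℝ} {ζ : μ → ℝ}
    (hsupp : ∀ i ∉ s, (Lᵀ *ᵥ (x - R *ᵥ ζ)) i = 0) (u : ι → ℝ) :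
    Lᵀ *ᵥ (x - R *ᵥ ζ) ⬝ᵥ Lᵀ *ᵥ (A *ᵥ x + B *ᵥ u
      - R *ᵥ (truncInv η s *ᵥ ((Lᵀ * A * R) *ᵥ ζ + (Lᵀ * B) *ᵥ u)))
      = -(1 / 2) * (C *ᵥ (x - R *ᵥ ζ) ⬝ᵥ C *ᵥ (x - R *ᵥ ζ)) := by
  have hobs := two_mul_dotProduct_of_lyapunov (by simp) h.obs (x - R *ᵥ ζ)
  have hA : Lᵀ *ᵥ (A *ᵥ x + B *ᵥ u) - ((Lᵀ * A * R) *ᵥ ζ + (Lᵀ * B) *ᵥ u)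
      = Lᵀ *ᵥ (A *ᵥ (x - R *ᵥ ζ)) := by
    simp only [mulVec_add, mulVec_sub, mulVec_mulVec, Matrix.mul_assoc]
    abel
  rw [mulVec_sub Lᵀ (A *ᵥ x + B *ᵥ u), dotProduct_sub, mulVec_mulVec _ Lᵀ R, h.balanced,
    dotProduct_diagonal_mulVec_truncInv_mulVec hs hsupp, ← dotProduct_sub, hA,
    dotProduct_transpose_mulVec, dotProduct_comm, mulVec_mulVec]
  linarith

-- `x - R ζ` is unobservable: the storage function `|Lᵀ (x - R ζ)|²` decreases at the rate
-- `|C (x - R ζ)|²` and vanishes initially.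
theorem IsBalancing.l2Norm_sub_eq_zero (h : IsBalancing A B C R L η) {s : Finset μ}
    (hs : ∀ i, i ∈ s ↔ η i ≠ 0) (hx : IsZeroTrajectory A B u x) {ζ : ℝ → μ → ℝ}
    (hζ : IsTruncatedTrajectory η s (Lᵀ * A * R) (Lᵀ * B) u ζ)
    (hu : ∀ t, 0 ≤ t → IntervalIntegrable u volume 0 t) {T : ℝ} (hT : 0 ≤ T) :
    l2Norm (volume.restrict (Set.Ioc 0 T)) (fun t => C *ᵥ (x t - R *ᵥ ζ t)) = 0 := by
  obtain ⟨ξ, hξ⟩ := hx.exists_eq_mulVec h.ctr hu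
  have hsupp : ∀ t, 0 ≤ t → ∀ i ∉ s, (Lᵀ *ᵥ (x t - R *ᵥ ζ t)) i = 0 := fun t ht i hi => by
    rw [hξ t ht, ← mulVec_sub, mulVec_mulVec, h.balanced, mulVec_diagonal,
      not_not.1 (mt (hs i).2 hi), zero_mul]
  have hnonneg := ((IsPrimitive.sub hx (hζ.isPrimitive.mulVec R)).mulVec
    Lᵀ).integral_dotProduct_nonneg hT
  rw [intervalIntegral.integral_congr fun t ht => h.dissipation_minimal (fun i => (hs i).1)
      (hsupp t (Set.uIcc_of_le hT ▸ ht).1) (u t),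
    intervalIntegral.integral_const_mul, intervalIntegral.integral_of_le hT, ← l2Norm_sq] at hnonneg
  nlinarith [sq_nonneg (l2Norm (volume.restrict (Set.Ioc 0 T)) fun t => C *ᵥ (x t - R *ᵥ ζ t))]

theorem IsBalancing.l2Norm_sub_le (h : IsBalancing A B C R L η) (hη : ∀ i, 0 ≤ η i)
    {s : Finset μ} (hs : ∀ i ∈ s, 0 < η i) (hx : IsZeroTrajectory A B u x) {ζ : ℝ → μ → ℝ}
    (hζ : IsTruncatedTrajectory η s (Lᵀ * A * R) (Lᵀ * B) u ζ) (hu : IsLocallyL2 u) {T : ℝ}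
    (hT : 0 ≤ T) :
    l2Norm (volume.restrict (Set.Ioc 0 T)) (fun t => C *ᵥ (x t - R *ᵥ ζ t))
      ≤ 2 * (∑ i ∈ sᶜ, η i) * l2Norm (volume.restrict (Set.Ioc 0 T)) u := by
  set t := sᶜ.filter (η · ≠ 0) with ht
  have hst : ∀ i, i ∈ s ∪ t ↔ η i ≠ 0 := fun i => by
    by_cases hi : i ∈ s
    · simp [hi, (hs i hi).ne']
    · simp [ht, hi]
  obtain ⟨ξ, hξ⟩ : ∃ ξ, IsTruncatedTrajectory η (s ∪ t) (Lᵀ * A * R) (Lᵀ * B) u ξ :=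
    exists_isZeroTrajectory _ _ fun T hT => hu.intervalIntegrable hT
  have hmin := h.l2Norm_sub_eq_zero hst hx hξ (fun T hT => hu.intervalIntegrable hT) hT
  have hchain := h.isBalanced.l2Norm_sub_le_of_union
    (disjoint_compl_right.mono_right (Finset.filter_subset _ _))
    (fun i hi => (hη i).lt_of_ne' ((hst i).1 hi)) hξ hζ hu hT
  have hsplit : (fun t => C *ᵥ (x t - R *ᵥ ζ t))
      = fun t => C *ᵥ (x t - R *ᵥ ξ t) + (C * R) *ᵥ (ξ t - ζ t) := by
    simp only [← mulVec_mulVec, mulVec_sub, sub_add_sub_cancel]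
  have hxξ := (IsPrimitive.sub hx (hξ.isPrimitive.mulVec R)).isLocallyL2_mulVec C T hT
  have hξζ := (hξ.isPrimitive.sub hζ.isPrimitive).isLocallyL2_mulVec (C * R) T hT
  rw [hsplit, ← Finset.sum_filter_ne_zero]
  refine (l2Norm_add_le hxξ (memLp_toLp_iff.1 hξζ).1).trans ?_
  rw [hmin, zero_add]
  exact hchain

end Balancing

section Projection

variable {ν μ ι κ : Type*} [Fintype ν] [DecidableEq μ] [Fintype ι] [Fintype κ] [DecidableEq κ]
  {η : μ → ℝ} {f : κ → μ}

/-- The inclusion of the coordinates `f` scaled by `diag(η ∘ f)^{-1/2}`. With balanced factors `R`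
and `L`, the projection matrices of balanced truncation are `R` and `L` times this matrix. -/
noncomputable def scaledInclusion (η : μ → ℝ) (f : κ → μ) : Matrix μ κ ℝ :=
  (1 : Matrix μ μ ℝ).submatrix id f * diagonal fun k => (√(η (f k)))⁻¹

theorem scaledInclusion_apply (η : μ → ℝ) (f : κ → μ) (i : μ) (k : κ) :
    scaledInclusion η f i k = if i = f k then (√(η (f k)))⁻¹ else 0 := by
  rw [scaledInclusion, mul_diagonal, submatrix_apply, id, one_apply, ite_mul, one_mul, zero_mul]

theorem scaledInclusion_mul_transpose (hf : f.Injective) (hη : ∀ k, 0 ≤ η (f k)) :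
    scaledInclusion η f * (scaledInclusion η f)ᵀ = truncInv η (Finset.univ.image f) := by
  ext i j
  simp only [mul_apply, transpose_apply, scaledInclusion_apply, truncInv, diagonal_apply,
    Finset.mem_image, Finset.mem_univ, true_and]
  by_cases hi : ∃ k, f k = i
  · obtain ⟨k, rfl⟩ := hi
    rw [Finset.sum_eq_single k (fun l _ hl => by simp [hf.ne hl.symm]) (by simp)]
    by_cases hj : f k = j
    · simp [← hj, ← mul_inv, Real.mul_self_sqrt (hη k)]
    · simp [hj, Ne.symm hj]
  · rw [Finset.sum_eq_zero fun k _ => by simp [show i ≠ f k from fun h => hi ⟨k, h.symm⟩]]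
    simp [hi]

variable [Fintype μ]

theorem diagonal_mul_scaledInclusion (η : μ → ℝ) (f : κ → μ) :
    diagonal η * scaledInclusion η f = scaledInclusion η f * diagonal (η ∘ f) := by
  ext i k
  rw [diagonal_mul, mul_diagonal, scaledInclusion_apply]
  split_ifs with h
  · rw [h, mul_comm, Function.comp_apply]
  · rw [mul_zero, zero_mul]

theorem scaledInclusion_transpose_mul_self (hf : f.Injective) :
    (scaledInclusion η f)ᵀ * scaledInclusion η f = diagonal fun k => (√(η (f k)))⁻¹ ^ 2 := by
  ext k l
  simp only [mul_apply, transpose_apply, scaledInclusion_apply]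
  rw [Finset.sum_eq_single (f k) (fun i _ hi => by simp [hi]) (by simp)]
  by_cases hkl : k = l
  · simp [hkl, sq]
  · simp [hkl, hf.ne hkl]

theorem scaledInclusion_transpose_mul_diagonal_mul (hf : f.Injective) (hη : ∀ k, 0 < η (f k)) :
    (scaledInclusion η f)ᵀ * (diagonal η * scaledInclusion η f) = 1 := by
  rw [diagonal_mul_scaledInclusion, ← Matrix.mul_assoc, scaledInclusion_transpose_mul_self hf,
    diagonal_mul_diagonal, ← diagonal_one]
  congr 1
  ext k
  rw [inv_pow, Real.sq_sqrt (hη k).le, Function.comp_apply, inv_mul_cancel₀ (hη k).ne']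

theorem IsZeroTrajectory.isTruncatedTrajectory {A : Matrix ν ν ℝ} {B : Matrix ν ι ℝ}
    {R L : Matrix ν μ ℝ} {u : ℝ → ι → ℝ} {ξ : ℝ → κ → ℝ}
    (hξ : IsZeroTrajectory ((L * scaledInclusion η f)ᵀ * A * (R * scaledInclusion η f))
      ((L * scaledInclusion η f)ᵀ * B) u ξ)
    (hf : f.Injective) (hη : ∀ k, 0 ≤ η (f k)) :
    IsTruncatedTrajectory η (Finset.univ.image f) (Lᵀ * A * R) (Lᵀ * B) u
      (fun t => scaledInclusion η f *ᵥ ξ t) := by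
  refine IsZeroTrajectory.mulVec hξ ?_ ?_ <;>
    simp only [← scaledInclusion_mul_transpose hf hη, Matrix.transpose_mul, Matrix.mul_assoc]

end Projection

section Lyapunov

open scoped ComplexOrder

variable {ν κ o : Type*} [Fintype ν] [Fintype κ] [Fintype o] {A Q : Matrix ν ν ℂ}
  {C : Matrix o ν ℂ} {v : ν → ℂ} {l : ℂ}

theorem two_re_mul_star_dotProduct_of_lyapunov (h : Aᴴ * Q + Q * A + Cᴴ * C = 0)
    (hv : A *ᵥ v = l • v) :
    ((2 * l.re : ℝ) : ℂ) * (star v ⬝ᵥ Q *ᵥ v) = -(star (C *ᵥ v) ⬝ᵥ (C *ᵥ v)) := by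
  have hz : star v ⬝ᵥ (Aᴴ * Q + Q * A + Cᴴ * C) *ᵥ v = 0 := by rw [h, zero_mulVec, dotProduct_zero]
  have hA : star v ⬝ᵥ Aᴴ *ᵥ (Q *ᵥ v) = star l * (star v ⬝ᵥ Q *ᵥ v) := by
    rw [dotProduct_mulVec, ← star_mulVec, hv, star_smul, smul_dotProduct, smul_eq_mul]
  have hC : star v ⬝ᵥ Cᴴ *ᵥ (C *ᵥ v) = star (C *ᵥ v) ⬝ᵥ (C *ᵥ v) := by
    rw [dotProduct_mulVec, ← star_mulVec]
  simp only [add_mulVec, dotProduct_add, ← mulVec_mulVec, hA, hC, hv, mulVec_smul,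
    dotProduct_smul, smul_eq_mul] at hz
  rw [← Complex.add_conj, add_mul, add_comm (l * _)]
  exact eq_neg_of_add_eq_zero_left hz

theorem mulVec_eq_zero_of_lyapunov_of_re_eq_zero (h : Aᴴ * Q + Q * A + Cᴴ * C = 0)
    (hv : A *ᵥ v = l • v) (hl : l.re = 0) : C *ᵥ v = 0 := by
  have hz := two_re_mul_star_dotProduct_of_lyapunov h hv
  rw [hl, mul_zero, Complex.ofReal_zero, zero_mul, eq_comm, neg_eq_zero] at hz
  exact dotProduct_star_self_eq_zero.1 hz

theorem conjTranspose_mulVec_of_lyapunov_of_re_eq_zero (h : Aᴴ * Q + Q * A + Cᴴ * C = 0)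
    (hv : A *ᵥ v = l • v) (hl : l.re = 0) : Aᴴ *ᵥ (Q *ᵥ v) = (-l) • (Q *ᵥ v) := by
  have hz : (Aᴴ * Q + Q * A + Cᴴ * C) *ᵥ v = 0 := by rw [h, zero_mulVec]
  simp only [add_mulVec, ← mulVec_mulVec, mulVec_eq_zero_of_lyapunov_of_re_eq_zero h hv hl, hv,
    mulVec_zero, add_zero, mulVec_smul] at hz
  rw [neg_smul, eq_neg_of_add_eq_zero_left hz]

theorem re_nonpos_of_lyapunov (hQ : Q.PosDef) (h : Aᴴ * Q + Q * A + Cᴴ * C = 0)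
    (hv : A *ᵥ v = l • v) (hv0 : v ≠ 0) : l.re ≤ 0 := by
  have hz := congrArg Complex.re (two_re_mul_star_dotProduct_of_lyapunov h hv)
  have hQv : 0 < (star v ⬝ᵥ Q *ᵥ v).re := (Complex.lt_def.1 (hQ.dotProduct_mulVec_pos hv0)).1
  have hCv : 0 ≤ (star (C *ᵥ v) ⬝ᵥ (C *ᵥ v)).re :=
    (Complex.le_def.1 (dotProduct_star_self_nonneg (C *ᵥ v))).1
  rw [Complex.re_ofReal_mul, Complex.neg_re] at hz
  by_contra hl
  linarith [mul_pos (not_le.1 hl) hQv]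

theorem lyapunov_galerkin {S : Matrix κ κ ℂ} {V W : Matrix ν κ ℂ} (hQ : Q.IsHermitian)
    (hS : S.IsHermitian) (h : Aᴴ * Q + Q * A + Cᴴ * C = 0) (hQV : Q * V = W * S) :
    (Wᴴ * A * V)ᴴ * S + S * (Wᴴ * A * V) + (C * V)ᴴ * (C * V) = 0 := by
  have hSW : S * Wᴴ = Vᴴ * Q := by
    rw [← hS.eq, ← conjTranspose_mul, ← hQV, conjTranspose_mul, hQ.eq]
  have hVV : Vᴴ * (Aᴴ * Q + Q * A + Cᴴ * C) * V = 0 := by simp [h]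
  rw [← hVV, ← Matrix.mul_assoc S, ← Matrix.mul_assoc S, hSW]
  simp only [conjTranspose_mul, conjTranspose_conjTranspose, Matrix.mul_add, Matrix.add_mul,
    Matrix.mul_assoc, hQV]

theorem galerkin_mulVec_of_re_eq_zero {S : Matrix κ κ ℂ} {V W : Matrix ν κ ℂ} {v : κ → ℂ}
    (hQ : Q.IsHermitian) (hS : S.IsHermitian) (h : Aᴴ * Q + Q * A + Cᴴ * C = 0)
    (hQV : Q * V = W * S) (hv : (Wᴴ * A * V) *ᵥ v = l • v) (hl : l.re = 0) :
    (Vᴴ * Aᴴ * W) *ᵥ (S *ᵥ v) = (-l) • (S *ᵥ v) ∧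
      (Aᴴ * W) *ᵥ (S *ᵥ v) = -((Q * A * V) *ᵥ v) := by
  have hred := lyapunov_galerkin hQ hS h hQV
  constructor
  · rw [← conjTranspose_mulVec_of_lyapunov_of_re_eq_zero hred hv hl]
    simp only [conjTranspose_mul, conjTranspose_conjTranspose, Matrix.mul_assoc]
  · have hz : ((Aᴴ * Q + Q * A + Cᴴ * C) * V) *ᵥ v = 0 := by rw [h, Matrix.zero_mul, zero_mulVec]
    rw [Matrix.add_mul, Matrix.add_mul, Matrix.mul_assoc Aᴴ, hQV, Matrix.mul_assoc Cᴴ, add_mulVec,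
      add_mulVec, ← mulVec_mulVec _ Cᴴ, mulVec_eq_zero_of_lyapunov_of_re_eq_zero hred hv hl,
      mulVec_zero, add_zero, ← Matrix.mul_assoc, ← mulVec_mulVec] at hz
    exact eq_neg_of_add_eq_zero_left hz

end Lyapunov

section Eigenvectors

theorem exists_mem_hasEigenvector_of_mapsTo {K E : Type*} [Field K] [IsAlgClosed K]
    [AddCommGroup E] [Module K E] [FiniteDimensional K E] {f : Module.End K E} {p : Submodule K E}
    (hp : p ≠ ⊥) (hf : ∀ v ∈ p, f v ∈ p) : ∃ l, ∃ v ∈ p, f.HasEigenvector l v := by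
  have : Nontrivial p := Submodule.nontrivial_iff_ne_bot.2 hp
  obtain ⟨l, hl⟩ := Module.End.exists_eigenvalue (f.restrict hf)
  obtain ⟨v, hv⟩ := hl.exists_hasEigenvector
  exact ⟨l, v, v.2, Module.End.mem_eigenspace_iff.2 (congrArg Subtype.val hv.apply_eq_smul),
    fun h => hv.2 (Subtype.ext h)⟩

theorem exists_eigenvector_diagonal_of_mapsTo {K ν : Type*} [Field K] [IsAlgClosed K] [Fintype ν]
    [DecidableEq ν] {d : ν → K} {p : Submodule K (ν → K)} (hp : p ≠ ⊥)
    (hd : ∀ v ∈ p, diagonal d *ᵥ v ∈ p) : ∃ i, ∃ v ∈ p, v ≠ 0 ∧ diagonal d *ᵥ v = d i • v := by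
  obtain ⟨l, v, hvp, hv⟩ := exists_mem_hasEigenvector_of_mapsTo (f := toLin' (diagonal d)) hp hd
  obtain ⟨i, rfl⟩ := (hasEigenvalue_toLin'_diagonal_iff d).1
    (Module.End.hasEigenvalue_of_hasEigenvector hv)
  exact ⟨i, v, hvp, hv.2, by simpa only [toLin'_apply] using hv.apply_eq_smul⟩

end Eigenvectors

section ReducedSpectrum

variable {ν κ ι o : Type*} [Fintype ν] [Fintype κ] [DecidableEq κ] [Fintype ι]
  [Fintype o] {A P Q : Matrix ν ν ℂ} {B : Matrix ν ι ℂ} {C : Matrix o ν ℂ} {V W : Matrix ν κ ℂ}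
  {s : κ → ℝ} {l : ℂ}

theorem exists_eigenvector_galerkin_of_re_eq_zero (hP : P.IsHermitian) (hQ : Q.IsHermitian)
    (hctr : A * P + P * Aᴴ + B * Bᴴ = 0) (hobs : Aᴴ * Q + Q * A + Cᴴ * C = 0)
    (hPW : P * W = V * diagonal fun k => (s k : ℂ)) (hQV : Q * V = W * diagonal fun k => (s k : ℂ))
    (hl : Module.End.HasEigenvalue (toLin' (Wᴴ * A * V)) l) (hre : l.re = 0) :
    ∃ k v, v ≠ 0 ∧ (Wᴴ * A * V) *ᵥ v = l • v ∧
      (P * Q) *ᵥ (V *ᵥ v) = ((s k : ℂ) ^ 2) • (V *ᵥ v) ∧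
      (P * Q) *ᵥ (A *ᵥ (V *ᵥ v)) = ((s k : ℂ) ^ 2) • (A *ᵥ (V *ᵥ v)) := by
  set S : Matrix κ κ ℂ := diagonal fun k => (s k : ℂ) with hS
  have hSS : S * S = diagonal fun k => (s k : ℂ) ^ 2 := by simp [hS, diagonal_mul_diagonal, sq]
  have hSh : S.IsHermitian := isHermitian_diagonal_iff.2 fun k => by simp [IsSelfAdjoint]
  have hdual : ∀ v, (Wᴴ * A * V) *ᵥ v = l • v →
      (Wᴴ * A * V) *ᵥ ((S * S) *ᵥ v) = l • ((S * S) *ᵥ v) ∧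
      (A * V) *ᵥ ((S * S) *ᵥ v) = (P * Q * A * V) *ᵥ v := fun v hv => by
    obtain ⟨hv', hQv⟩ := galerkin_mulVec_of_re_eq_zero hQ hSh hobs hQV hv hre
    obtain ⟨hv'', hPv⟩ := galerkin_mulVec_of_re_eq_zero (A := Aᴴ) (C := Bᴴ) hP hSh
      (by simpa using hctr) hPW hv' (by simp [hre])
    refine ⟨by simpa only [conjTranspose_conjTranspose, mulVec_mulVec, neg_neg] using hv'', ?_⟩
    rw [conjTranspose_conjTranspose, Matrix.mul_assoc P, ← mulVec_mulVec _ P, hQv, mulVec_neg,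
      neg_neg] at hPv
    simpa only [mulVec_mulVec, Matrix.mul_assoc] using hPv
  obtain ⟨k, v, hv, hv0, hvk⟩ := exists_eigenvector_diagonal_of_mapsTo hl fun v hv => by
    rw [Module.End.mem_eigenspace_iff, toLin'_apply] at hv ⊢
    rw [← hSS]
    exact (hdual v hv).1
  rw [Module.End.mem_eigenspace_iff, toLin'_apply] at hv
  refine ⟨k, v, hv0, hv, ?_, ?_⟩
  · rw [mulVec_mulVec, Matrix.mul_assoc, hQV, ← Matrix.mul_assoc, hPW, Matrix.mul_assoc, hSS,
      ← mulVec_mulVec, hvk, mulVec_smul]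
  · rw [mulVec_mulVec, mulVec_mulVec, ← (hdual v hv).2, hSS, hvk, mulVec_smul,
      mulVec_mulVec]

-- The residual `A V v - l V v` of an eigenvector `v` of `Wᴴ A V` would be an eigenvector of `P Q`
-- of the kind excluded by `hgap`.
theorem hasEigenvalue_of_galerkin_of_re_eq_zero [DecidableEq ν] (hP : P.IsHermitian)
    (hQ : Q.IsHermitian) (hctr : A * P + P * Aᴴ + B * Bᴴ = 0) (hobs : Aᴴ * Q + Q * A + Cᴴ * C = 0)
    (hPW : P * W = V * diagonal fun k => (s k : ℂ)) (hQV : Q * V = W * diagonal fun k => (s k : ℂ))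
    (hWV : Wᴴ * V = 1)
    (hgap : ∀ k d, (P * Q) *ᵥ d = ((s k : ℂ) ^ 2) • d → Wᴴ *ᵥ d = 0 → d = 0)
    (hl : Module.End.HasEigenvalue (toLin' (Wᴴ * A * V)) l) (hre : l.re = 0) :
    Module.End.HasEigenvalue (toLin' A) l := by
  obtain ⟨k, v, hv0, hv, hPQV, hPQA⟩ :=
    exists_eigenvector_galerkin_of_re_eq_zero hP hQ hctr hobs hPW hQV hl hre
  have hresidual : A *ᵥ (V *ᵥ v) - l • (V *ᵥ v) = 0 := by
    refine hgap k _ ?_ ?_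
    · rw [mulVec_sub, mulVec_smul, hPQV, hPQA, smul_sub, smul_comm l]
    · rw [mulVec_sub, mulVec_smul, mulVec_mulVec v Wᴴ, hWV, one_mulVec, mulVec_mulVec,
        mulVec_mulVec, hv, sub_self]
  refine Module.End.hasEigenvalue_of_hasEigenvector (x := V *ᵥ v)
    ⟨Module.End.mem_eigenspace_iff.2 (sub_eq_zero.1 hresidual), fun h => hv0 ?_⟩
  rw [← one_mulVec v, ← hWV, ← mulVec_mulVec, h, mulVec_zero]

theorem eq_zero_of_mulVec_eq_smul {μ : Type*} [Fintype μ] [DecidableEq μ] {R L : Matrix ν μ ℂ}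
    {σ : μ → ℂ} (hLR : Lᴴ * R = diagonal σ) (hRL : Rᴴ * L = diagonal σ) {m : ℂ} (hm : m ≠ 0)
    {d : ν → ℂ} (hd : (R * Rᴴ * (L * Lᴴ)) *ᵥ d = m • d)
    (hz : ∀ j, σ j ^ 2 = m → (Lᴴ *ᵥ d) j = 0) : d = 0 := by
  have hLd : Lᴴ *ᵥ d = 0 := by
    have hsq : (diagonal σ * diagonal σ) *ᵥ (Lᴴ *ᵥ d) = m • (Lᴴ *ᵥ d) := by
      rw [← mulVec_smul, ← hd]
      nth_rewrite 1 [← hLR]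
      rw [← hRL]
      simp only [mulVec_mulVec, Matrix.mul_assoc]
    ext j
    by_cases hj : σ j ^ 2 = m
    · exact hz j hj
    · have hsqj := congrFun hsq j
      rw [diagonal_mul_diagonal, mulVec_diagonal, Pi.smul_apply, smul_eq_mul, ← sq] at hsqj
      exact (mul_eq_mul_right_iff.1 hsqj).resolve_left hj
  rw [← Matrix.mul_assoc, ← mulVec_mulVec, hLd, mulVec_zero] at hd
  exact (smul_eq_zero.1 hd.symm).resolve_left hm

end ReducedSpectrum

section Complexification

variable {μ ν ι : Type*} [Fintype ν]

theorem map_ofReal_mul (M : Matrix μ ν ℝ) (N : Matrix ν ι ℝ) :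
    (M * N).map Complex.ofReal = M.map Complex.ofReal * N.map Complex.ofReal :=
  Matrix.map_mul (f := Complex.ofRealHom)

omit [Fintype ν] in
theorem map_ofReal_transpose (M : Matrix μ ν ℝ) :
    Mᵀ.map Complex.ofReal = (M.map Complex.ofReal)ᴴ := by
  ext i j
  exact (Complex.conj_ofReal _).symm

theorem isHermitian_map_ofReal_mul_transpose (M : Matrix μ ν ℝ) :
    ((M * Mᵀ).map Complex.ofReal).IsHermitian := by
  rw [IsHermitian, ← map_ofReal_transpose, Matrix.transpose_mul, transpose_transpose]

theorem lyapunov_map_ofReal [Fintype ι] {A Q : Matrix ν ν ℝ} {C : Matrix ι ν ℝ}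
    (h : Aᵀ * Q + Q * A + Cᵀ * C = 0) :
    (A.map Complex.ofReal)ᴴ * Q.map Complex.ofReal + Q.map Complex.ofReal * A.map Complex.ofReal
      + (C.map Complex.ofReal)ᴴ * C.map Complex.ofReal = 0 := by
  simpa only [Matrix.map_add _ Complex.ofReal_add, map_ofReal_mul, map_ofReal_transpose,
    Matrix.map_zero _ Complex.ofReal_zero] using congrArg (·.map Complex.ofReal) h

end Complexification

section Stability

open scoped ComplexOrder

variable {μ ι o : Type*} [Fintype μ] [DecidableEq μ] [Fintype ι] [Fintype o] {n r : ℕ}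
  {A : Matrix (Fin n) (Fin n) ℝ} {B : Matrix (Fin n) ι ℝ} {C : Matrix o (Fin n) ℝ}
  {R L : Matrix (Fin n) μ ℝ} {η : μ → ℝ} {f : Fin r → μ}

theorem IsBalancing.gramian_mul (h : IsBalancing A B C R L η) (f : Fin r → μ) :
    (L * Lᵀ).map Complex.ofReal * (R * scaledInclusion η f).map Complex.ofReal
      = (L * scaledInclusion η f).map Complex.ofReal * diagonal fun k => (η (f k) : ℂ) := by
  have hreal : L * Lᵀ * (R * scaledInclusion η f) = L * scaledInclusion η f * diagonal (η ∘ f) := by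
    rw [Matrix.mul_assoc L, ← Matrix.mul_assoc Lᵀ, h.balanced, diagonal_mul_scaledInclusion,
      Matrix.mul_assoc]
  rw [← map_ofReal_mul, hreal, map_ofReal_mul, diagonal_map Complex.ofReal_zero]
  rfl

theorem IsBalancing.swap (h : IsBalancing A B C R L η) : IsBalancing Aᵀ Cᵀ Bᵀ L R η where
  ctr := by simpa using h.obs
  obs := by simpa using h.ctr
  balanced := h.transpose_mul

theorem IsBalancing.transpose_mul_eq_one (h : IsBalancing A B C R L η) (hf : f.Injective)
    (hη : ∀ k, 0 < η (f k)) : (L * scaledInclusion η f)ᵀ * (R * scaledInclusion η f) = 1 := by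
  rw [Matrix.transpose_mul, Matrix.mul_assoc, ← Matrix.mul_assoc Lᵀ, h.balanced,
    scaledInclusion_transpose_mul_diagonal_mul hf hη]

theorem scaledInclusion_conjTranspose_mulVec (w : μ → ℂ) (k : Fin r) :
    (((scaledInclusion η f).map Complex.ofReal)ᴴ *ᵥ w) k = ((√(η (f k)))⁻¹ : ℝ) * w (f k) := by
  simp only [mulVec, dotProduct, conjTranspose_apply, map_apply, scaledInclusion_apply]
  rw [Finset.sum_eq_single (f k) (fun i _ hi => by simp [hi]) (by simp)]
  simp

theorem IsBalancing.eq_zero_of_hankel_eigenvector (h : IsBalancing A B C R L η)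
    (hη₀ : ∀ i, 0 ≤ η i) (hη : ∀ k, 0 < η (f k)) (hgap : ∀ k, ∀ j ∉ Set.range f, η j ≠ η (f k))
    {k : Fin r} {d : Fin n → ℂ}
    (hd : ((R * Rᵀ).map Complex.ofReal * (L * Lᵀ).map Complex.ofReal) *ᵥ d
      = ((η (f k) : ℂ) ^ 2) • d)
    (hWd : ((L * scaledInclusion η f).map Complex.ofReal)ᴴ *ᵥ d = 0) : d = 0 := by
  have hLR : (L.map Complex.ofReal)ᴴ * R.map Complex.ofReal = diagonal fun i => (η i : ℂ) := by
    rw [← map_ofReal_transpose, ← map_ofReal_mul, h.balanced, diagonal_map Complex.ofReal_zero]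
  have hRL : (R.map Complex.ofReal)ᴴ * L.map Complex.ofReal = diagonal fun i => (η i : ℂ) := by
    rw [← map_ofReal_transpose, ← map_ofReal_mul, h.transpose_mul, diagonal_map Complex.ofReal_zero]
  rw [map_ofReal_mul, map_ofReal_mul, map_ofReal_transpose, map_ofReal_transpose] at hd
  refine eq_zero_of_mulVec_eq_smul hLR hRL
    (pow_ne_zero 2 (Complex.ofReal_ne_zero.2 (hη k).ne')) hd fun j hj => ?_
  have hjk : η j = η (f k) := by
    have : η j ^ 2 = η (f k) ^ 2 := mod_cast hj
    exact (sq_eq_sq₀ (hη₀ j) (hη₀ _)).1 this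
  obtain ⟨l, rfl⟩ : j ∈ Set.range f := not_not.1 fun hj' => hgap k j hj' hjk
  have hl := congrFun hWd l
  rw [map_ofReal_mul, conjTranspose_mul, ← mulVec_mulVec, scaledInclusion_conjTranspose_mulVec,
    Pi.zero_apply] at hl
  exact (mul_eq_zero.1 hl).resolve_left
    (Complex.ofReal_ne_zero.2 (inv_ne_zero (Real.sqrt_ne_zero'.2 (hη l))))

-- The Pernebo–Silverman theorem.
theorem IsBalancing.isAsymptoticallyStable (h : IsBalancing A B C R L η)
    (hA : IsAsymptoticallyStable A) (hf : f.Injective) (hη₀ : ∀ i, 0 ≤ η i)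
    (hη : ∀ k, 0 < η (f k)) (hgap : ∀ k, ∀ j ∉ Set.range f, η j ≠ η (f k)) :
    IsAsymptoticallyStable ((L * scaledInclusion η f)ᵀ * A * (R * scaledInclusion η f)) := by
  intro l hl
  rw [map_ofReal_mul, map_ofReal_mul, map_ofReal_transpose] at hl
  have hobs := lyapunov_map_ofReal h.obs
  have hctr : A.map Complex.ofReal * (R * Rᵀ).map Complex.ofReal
      + (R * Rᵀ).map Complex.ofReal * (A.map Complex.ofReal)ᴴ
      + B.map Complex.ofReal * (B.map Complex.ofReal)ᴴ = 0 := by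
    simpa only [map_ofReal_transpose, conjTranspose_conjTranspose]
      using lyapunov_map_ofReal h.swap.obs
  have hWV : ((L * scaledInclusion η f).map Complex.ofReal)ᴴ
      * (R * scaledInclusion η f).map Complex.ofReal = 1 := by
    rw [← map_ofReal_transpose, ← map_ofReal_mul, h.transpose_mul_eq_one hf hη,
      Matrix.map_one _ Complex.ofReal_zero Complex.ofReal_one]
  have hSpos : (diagonal fun k => (η (f k) : ℂ)).PosDef :=
    PosDef.diagonal fun k => by exact_mod_cast hη k
  obtain ⟨v, hv⟩ := hl.exists_hasEigenvector
  have hre_nonpos : l.re ≤ 0 := re_nonpos_of_lyapunov hSpos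
    (lyapunov_galerkin (isHermitian_map_ofReal_mul_transpose L) hSpos.isHermitian hobs
      (h.gramian_mul f)) hv.apply_eq_smul hv.2
  exact hre_nonpos.lt_of_ne fun hre => (hA l (hasEigenvalue_of_galerkin_of_re_eq_zero
    (isHermitian_map_ofReal_mul_transpose R) (isHermitian_map_ofReal_mul_transpose L) hctr hobs
    (h.swap.gramian_mul f) (h.gramian_mul f) hWV
    (fun _ _ => h.eq_zero_of_hankel_eigenvector hη₀ hη hgap) hl hre)).ne hre

end Stability

section ErrorBound

variable {ν μ ι o κ : Type*} [Fintype ν] [Fintype μ] [DecidableEq μ] [Fintype ι] [Fintype o]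
  [Fintype κ] [DecidableEq κ] {A : Matrix ν ν ℝ} {B : Matrix ν ι ℝ} {C : Matrix o ν ℝ}
  {R L : Matrix ν μ ℝ} {η : μ → ℝ} {f : κ → μ} {u : ℝ → ι → ℝ} {x : ℝ → ν → ℝ} {ξ : ℝ → κ → ℝ}

theorem IsBalancing.l2Norm_output_sub_le (h : IsBalancing A B C R L η) (hη₀ : ∀ i, 0 ≤ η i)
    (hf : f.Injective) (hη : ∀ k, 0 < η (f k)) (hx : IsZeroTrajectory A B u x)
    (hξ : IsZeroTrajectory ((L * scaledInclusion η f)ᵀ * A * (R * scaledInclusion η f))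
      ((L * scaledInclusion η f)ᵀ * B) u ξ)
    (hu : IsLocallyL2 u) {T : ℝ} (hT : 0 ≤ T) :
    l2Norm (volume.restrict (Set.Ioc 0 T))
        (fun t => C *ᵥ x t - (C * (R * scaledInclusion η f)) *ᵥ ξ t)
      ≤ 2 * (∑ i ∈ (Finset.univ.image f)ᶜ, η i) * l2Norm (volume.restrict (Set.Ioc 0 T)) u := by
  have hpos : ∀ i ∈ Finset.univ.image f, 0 < η i := by simpa using hη
  simpa only [mulVec_sub, mulVec_mulVec] using
    h.l2Norm_sub_le hη₀ hpos hx (hξ.isTruncatedTrajectory hf fun k => (hη k).le) hu hT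

theorem memL2_and_normL2_le_of_forall_le {p : ℕ} {g : ℝ → Fin p → ℝ}
    (hg : ContinuousOn g (Set.Ici 0)) {c : ℝ} (hc : 0 ≤ c)
    (hb : ∀ T, 0 ≤ T → l2Norm (volume.restrict (Set.Ioc 0 T)) g ≤ c) :
    MemL2 g ∧ normL2 g ≤ c :=
  have h := integrableOn_and_l2Norm_le_of_forall_le (isLocallyL2_of_continuousOn hg) hc hb
  ⟨⟨hg.aestronglyMeasurable measurableSet_Ici, h.1⟩, h.2⟩

theorem IsBalancing.memL2_output_sub {p : ℕ} {C : Matrix (Fin p) ν ℝ}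
    (h : IsBalancing A B C R L η) (hη₀ : ∀ i, 0 ≤ η i) (hf : f.Injective) (hη : ∀ k, 0 < η (f k))
    (hx : IsZeroTrajectory A B u x)
    (hξ : IsZeroTrajectory ((L * scaledInclusion η f)ᵀ * A * (R * scaledInclusion η f))
      ((L * scaledInclusion η f)ᵀ * B) u ξ)
    (hu : IsLocallyL2 u) {c : ℝ} (hc : ∀ T, l2Norm (volume.restrict (Set.Ioc 0 T)) u ≤ c)
    {e : ℝ → Fin p → ℝ}
    (he : ∀ t, 0 ≤ t → e t = C *ᵥ x t - (C * (R * scaledInclusion η f)) *ᵥ ξ t) :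
    MemL2 e ∧ normL2 e ≤ 2 * (∑ i ∈ (Finset.univ.image f)ᶜ, η i) * c := by
  have hcont := ((IsPrimitive.mulVec hx C).continuousOn.sub
    (IsPrimitive.mulVec hξ (C * (R * scaledInclusion η f))).continuousOn).congr he
  have hsum : 0 ≤ 2 * ∑ i ∈ (Finset.univ.image f)ᶜ, η i :=
    mul_nonneg zero_le_two (Finset.sum_nonneg fun i _ => hη₀ i)
  refine memL2_and_normL2_le_of_forall_le hcont
    (mul_nonneg hsum (l2Norm_nonneg.trans (hc 0))) fun T hT => ?_
  rw [l2Norm_restrict_congr measurableSet_Ioc fun t ht => he t ht.1.le]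
  exact (h.l2Norm_output_sub_le hη₀ hf hη hx hξ hu hT).trans
    (mul_le_mul_of_nonneg_left (hc T) hsum)

end ErrorBound

section BalancedTruncation

variable {n r : ℕ} {ι κ : Type*} [Fintype ι] [Fintype κ] {A : Matrix (Fin n) (Fin n) ℝ}
  {B : Matrix (Fin n) ι ℝ} {C : Matrix κ (Fin n) ℝ} {V W : Matrix (Fin n) (Fin r) ℝ}
  {η : Fin n → ℝ}

theorem mul_mul_transpose_of_mem_orthogonalGroup {R U : Matrix (Fin n) (Fin n) ℝ}
    (hU : U ∈ orthogonalGroup (Fin n) ℝ) : R * U * (R * U)ᵀ = R * Rᵀ := by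
  rw [Matrix.transpose_mul, Matrix.mul_assoc, ← Matrix.mul_assoc U,
    (mem_orthogonalGroup_iff _ _).1 hU, Matrix.one_mul]

theorem mul_leadingCols_mul_diagonal (hr : r ≤ n) (R Z : Matrix (Fin n) (Fin n) ℝ) :
    R * leadingCols hr Z * diagonal (fun i : Fin r => (√(η (Fin.castLE hr i)))⁻¹)
      = R * Z * scaledInclusion η (Fin.castLE hr) := by
  have hZ : Z * (1 : Matrix (Fin n) (Fin n) ℝ).submatrix id (Fin.castLE hr) = leadingCols hr Z :=
    mul_submatrix_one (Equiv.refl _) _ Z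
  rw [scaledInclusion, ← hZ]
  simp only [Matrix.mul_assoc]

theorem IsBalancedTruncation.exists_isBalancing {hr : r ≤ n}
    (h : IsBalancedTruncation A B C hr V W η) :
    ∃ R L, IsBalancing A B C R L η ∧ V = R * scaledInclusion η (Fin.castLE hr) ∧
      W = L * scaledInclusion η (Fin.castLE hr) := by
  obtain ⟨-, -, _, _, R, L, U, Z, hP, hQ, rfl, rfl, hU, hZ, hsvd, rfl, rfl⟩ := h
  refine ⟨R * Z, L * U, ⟨?_, ?_, ?_⟩, mul_leadingCols_mul_diagonal hr R Z,
    mul_leadingCols_mul_diagonal hr L U⟩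
  · rwa [mul_mul_transpose_of_mem_orthogonalGroup hZ]
  · rwa [mul_mul_transpose_of_mem_orthogonalGroup hU]
  · calc (L * U)ᵀ * (R * Z) = Uᵀ * (Lᵀ * R) * Z := by
          simp only [Matrix.transpose_mul, Matrix.mul_assoc]
      _ = Uᵀ * U * diagonal η * (Zᵀ * Z) := by simp only [hsvd, Matrix.mul_assoc]
      _ = diagonal η := by
          rw [(mem_orthogonalGroup_iff' _ _).1 hU, (mem_orthogonalGroup_iff' _ _).1 hZ,
            Matrix.one_mul, Matrix.mul_one]

theorem compl_image_castLE (hr : r ≤ n) : (Finset.univ.image (Fin.castLE hr))ᶜ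
    = Finset.univ.filter fun i : Fin n => r ≤ (i : ℕ) := by
  ext i
  simp only [Finset.mem_compl, Finset.mem_image, Finset.mem_univ, true_and,
    Finset.mem_filter, ← Set.mem_range, Fin.range_castLE, Set.mem_ofPred_eq, not_lt]

theorem lt_castLE_of_gap (hη : Antitone η) (hrn : r < n) {a : Fin n} (ha : (a : ℕ) + 1 = r)
    (hgap : η ⟨r, hrn⟩ < η a) (k : Fin r) {j : Fin n}
    (hj : j ∉ Set.range (Fin.castLE hrn.le)) : η j < η (Fin.castLE hrn.le k) := by
  rw [Fin.range_castLE, Set.mem_ofPred_eq, not_lt] at hj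
  exact (hη (Fin.le_def.2 hj)).trans_lt <|
    hgap.trans_le (hη (Fin.le_def.2 (Nat.lt_succ_iff.1 (k.2.trans_eq ha.symm))))

end BalancedTruncation

section Shift

variable {n m p q r : ℕ} {A : Matrix (Fin n) (Fin n) ℝ} {B : Matrix (Fin n) (Fin m) ℝ}
  {C : Matrix (Fin p) (Fin n) ℝ} {D : Matrix (Fin p) (Fin m) ℝ} {X₀ : Matrix (Fin n) (Fin q) ℝ}
  {u : ℝ → Fin m → ℝ} {α β : ℝ} {z₀ : Fin q → ℝ} {x : ℝ → Fin n → ℝ}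
  {V W : Matrix (Fin n) (Fin r) ℝ} {xr : ℝ → Fin r → ℝ}

/-- The input `[u, β √(2α) e^{-α t} z₀]` of the system with input matrix `expandedInput`. The factor
`√(2α)` normalizes the `L²` norm of `t ↦ e^{-α t}`. -/
noncomputable def extendedInput (u : ℝ → Fin m → ℝ) (α β : ℝ) (z₀ : Fin q → ℝ) (t : ℝ) :
    Fin m ⊕ Fin q → ℝ :=
  Sum.elim (u t) ((β * √(2 * α) * Real.exp (-α * t)) • z₀)

theorem extendedInput_dotProduct_self (hα : 0 ≤ α) (t : ℝ) :
    extendedInput u α β z₀ t ⬝ᵥ extendedInput u α β z₀ t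
      = u t ⬝ᵥ u t + 2 * α * β ^ 2 * (z₀ ⬝ᵥ z₀) * Real.exp (-(2 * α) * t) := by
  have hexp : Real.exp (-(2 * α) * t) = Real.exp (-α * t) ^ 2 := by
    rw [← Real.exp_nat_mul]
    ring_nf
  rw [extendedInput, sumElim_dotProduct_sumElim, smul_dotProduct, dotProduct_smul, hexp]
  simp only [smul_eq_mul]
  linear_combination
    β ^ 2 * Real.exp (-α * t) ^ 2 * (z₀ ⬝ᵥ z₀) * Real.sq_sqrt (mul_nonneg zero_le_two hα)

theorem integrableOn_Ici_exp_neg_mul (hα : 0 < α) :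
    IntegrableOn (fun t => Real.exp (-α * t)) (Set.Ici 0) :=
  (integrableOn_Ici_iff_integrableOn_Ioi (by simp)).2
    (integrableOn_exp_mul_Ioi (neg_neg_of_pos hα) 0)

theorem MemL2.memLp_extendedInput (hu : MemL2 u) (hα : 0 < α) :
    MemLp (fun t => WithLp.toLp 2 (extendedInput u α β z₀ t)) 2 (volume.restrict (Set.Ici 0)) := by
  refine memLp_toLp_iff.2 ⟨?_, ?_⟩
  · have hexp : Continuous fun t => (β * √(2 * α) * Real.exp (-α * t)) • z₀ := by fun_prop
    have hsum := (Homeomorph.sumArrowHomeomorphProdArrow (ι := Fin m) (ι' := Fin q)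
      (X := ℝ)).symm.continuous
    exact hsum.comp_aestronglyMeasurable (hu.1.prodMk hexp.aestronglyMeasurable)
  · simp only [extendedInput_dotProduct_self hα.le]
    exact hu.2.add ((integrableOn_Ici_exp_neg_mul (by linarith)).const_mul _)

theorem MemL2.isLocallyL2_extendedInput (hu : MemL2 u) (hα : 0 < α) :
    IsLocallyL2 (extendedInput u α β z₀) := fun _ _ =>
  (hu.memLp_extendedInput hα).mono_measure
    (Measure.restrict_mono (fun _ ht => ht.1.le) le_rfl)

theorem MemL2.l2Norm_extendedInput_sq (hu : MemL2 u) (hα : 0 < α) :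
    l2Norm (volume.restrict (Set.Ici 0)) (extendedInput u α β z₀) ^ 2
      = normL2 u ^ 2 + (β * ‖WithLp.toLp 2 z₀‖) ^ 2 := by
  have hexp := integrableOn_Ici_exp_neg_mul (mul_pos zero_lt_two hα)
  rw [l2Norm_sq]
  simp only [extendedInput_dotProduct_self hα.le]
  rw [integral_add hu.2 (hexp.const_mul _), integral_const_mul,
    integral_Ici_eq_integral_Ioi (f := fun t => Real.exp (-(2 * α) * t)),
    integral_exp_mul_Ioi (by linarith), mul_pow, norm_toLp_sq, ← l2Norm_sq]
  simp only [mul_zero, Real.exp_zero]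
  field_simp
  rfl

theorem MemL2.l2Norm_extendedInput_le (hu : MemL2 u) (hα : 0 < α) (hβ : 0 ≤ β) {T : ℝ} :
    l2Norm (volume.restrict (Set.Ioc 0 T)) (extendedInput u α β z₀)
      ≤ normL2 u + β * ‖WithLp.toLp 2 z₀‖ := by
  have hu₀ : 0 ≤ normL2 u := Real.sqrt_nonneg _
  have hz₀ : 0 ≤ β * ‖WithLp.toLp 2 z₀‖ := by positivity
  refine (l2Norm_mono_measure (Measure.restrict_mono (fun _ ht => ht.1.le) le_rfl)
    (memLp_toLp_iff.1 (hu.memLp_extendedInput hα)).2).trans ?_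
  refine le_of_sq_le_sq ?_ (add_nonneg hu₀ hz₀)
  rw [hu.l2Norm_extendedInput_sq hα]
  nlinarith [mul_nonneg hu₀ hz₀]

theorem isPrimitive_sub_exp_smul (α : ℝ) (v : Fin n → ℝ) :
    IsPrimitive (fun t => (α * Real.exp (-α * t)) • v) (fun t => v - Real.exp (-α * t) • v) := by
  refine IsPrimitive.of_hasDerivAt (fun t => ?_) (by fun_prop) (by simp)
  have hexp := ((hasDerivAt_id t).const_mul (-α)).exp
  refine ((hexp.smul_const v).const_sub v).congr_deriv ?_
  rw [← neg_smul, id]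
  congr 1
  ring

-- `e^{-α t} X z₀` solves `ẇ = A w - e^{-α t} (A + α I) X z₀`, so that subtracting it turns the
-- initial state into an additional input.
theorem IsStateTrajectory.shift {X H : Matrix (Fin n) (Fin q) ℝ}
    (hx : IsStateTrajectory A B u (X *ᵥ z₀) x)
    (hH : (A + α • (1 : Matrix (Fin n) (Fin n) ℝ)) * X = H) (hα : 0 < α) (hβ : β ≠ 0) :
    IsZeroTrajectory A (fromCols B ((1 / (β * √(2 * α))) • H)) (extendedInput u α β z₀)
      (fun t => x t - Real.exp (-α * t) • (X *ᵥ z₀)) := by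
  have hprim : IsPrimitive (fun s => A *ᵥ x s + B *ᵥ u s) (fun t => x t - X *ᵥ z₀) := fun t ht =>
    ⟨(hx.2 t ht).1, sub_eq_of_eq_add' (hx.2 t ht).2⟩
  refine (hprim.add (isPrimitive_sub_exp_smul α (X *ᵥ z₀))).congr (fun t _ => ?_)
    fun t _ => by abel
  have hHz : H *ᵥ z₀ = A *ᵥ (X *ᵥ z₀) + α • (X *ᵥ z₀) := by
    rw [← hH, ← mulVec_mulVec, add_mulVec, smul_mulVec, one_mulVec]
  have hγ : β * √(2 * α) ≠ 0 := by positivity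
  rw [extendedInput, fromCols_mulVec_sumElim, smul_mulVec, mulVec_smul, smul_smul, ← mul_assoc,
    one_div_mul_cancel hγ, one_mul, hHz, mulVec_sub, mulVec_smul, smul_add, smul_smul,
    mul_comm (Real.exp _) α]
  abel

theorem isUnit_det_add_smul_one {a : Matrix (Fin r) (Fin r) ℝ}
    (h : ¬ Module.End.HasEigenvalue (toLin' a) (-α)) :
    IsUnit (a + α • (1 : Matrix (Fin r) (Fin r) ℝ)).det := by
  refine isUnit_iff_ne_zero.2 fun hdet => h ?_
  obtain ⟨v, hv0, hv⟩ := exists_mulVec_eq_zero_iff.2 hdet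
  refine Module.End.hasEigenvalue_of_hasEigenvector (x := v)
    ⟨Module.End.mem_eigenspace_iff.2 ?_, hv0⟩
  rw [add_mulVec, smul_mulVec, one_mulVec] at hv
  rw [toLin'_apply, neg_smul]
  exact eq_neg_of_add_eq_zero_left hv

theorem mul_reducedInitialMap (h : ¬ Module.End.HasEigenvalue (toLin' (Wᵀ * A * V)) (-α)) :
    (Wᵀ * A * V + α • (1 : Matrix (Fin r) (Fin r) ℝ)) * reducedInitialMap A X₀ α V W
      = Wᵀ * ((A + α • (1 : Matrix (Fin n) (Fin n) ℝ)) * X₀) := by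
  rw [reducedInitialMap, mul_nonsing_inv_cancel_left _ _ (isUnit_det_add_smul_one h),
    Matrix.mul_assoc]

theorem transpose_mul_expandedInput (A : Matrix (Fin n) (Fin n) ℝ) (B : Matrix (Fin n) (Fin m) ℝ)
    (X₀ : Matrix (Fin n) (Fin q) ℝ) (α β : ℝ) (W : Matrix (Fin n) (Fin r) ℝ) :
    Wᵀ * expandedInput A B X₀ α β = fromCols (Wᵀ * B)
      ((1 / (β * √(2 * α))) • (Wᵀ * ((A + α • (1 : Matrix (Fin n) (Fin n) ℝ)) * X₀))) := by
  rw [expandedInput, mul_fromCols, Matrix.mul_smul]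

theorem IsStateTrajectory.shift_jShiftBT
    (h : ¬ Module.End.HasEigenvalue (toLin' (Wᵀ * A * V)) (-α)) (hα : 0 < α) (hβ : β ≠ 0)
    (hxr : IsStateTrajectory (Wᵀ * A * V) (Wᵀ * B) u (reducedInitialMap A X₀ α V W *ᵥ z₀) xr) :
    IsZeroTrajectory (Wᵀ * A * V) (Wᵀ * expandedInput A B X₀ α β) (extendedInput u α β z₀)
      (fun t => xr t - Real.exp (-α * t) • (reducedInitialMap A X₀ α V W *ᵥ z₀)) := by
  rw [transpose_mul_expandedInput]
  exact hxr.shift (mul_reducedInitialMap h) hα hβ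

theorem jShiftBT_output_sub (v : Fin n → ℝ) (w : Fin r → ℝ) (d : Fin p → ℝ) (t : ℝ) :
    C *ᵥ v + d - ((C * V) *ᵥ w + d + (jShiftBT A B C D X₀ α V W).f z₀ t)
      = C *ᵥ (v - Real.exp (-α * t) • (X₀ *ᵥ z₀)) - (C * V) *ᵥ (w -
          Real.exp (-α * t) • (reducedInitialMap A X₀ α V W *ᵥ z₀)) := by
  simp only [jShiftBT, mulVec_sub, sub_mulVec, mulVec_smul, mulVec_mulVec, smul_sub,
    Matrix.mul_assoc]
  abel

end Shift

end ShiftBT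

theorem theorem1 {n m p q r : ℕ} (hr : 0 < r) (hrn : r < n)
    (A : Matrix (Fin n) (Fin n) ℝ) (B : Matrix (Fin n) (Fin m) ℝ)
    (C : Matrix (Fin p) (Fin n) ℝ) (D : Matrix (Fin p) (Fin m) ℝ)
    (X₀ : Matrix (Fin n) (Fin q) ℝ)
    (hA : ShiftBT.IsAsymptoticallyStable A)
    (α β : ℝ) (hα : 0 < α) (hβ : 0 < β)
    (V W : Matrix (Fin n) (Fin r) ℝ) (η : Fin n → ℝ)
    (hBT : ShiftBT.IsBalancedTruncation A (ShiftBT.expandedInput A B X₀ α β) C hrn.le V W η)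
    (hgap : η ⟨r - 1, by omega⟩ > η ⟨r, hrn⟩)
    (M : ShiftBT.ReducedModel r m p q) (hM : M = ShiftBT.jShiftBT A B C D X₀ α V W)
    (hspec : ¬ Module.End.HasEigenvalue (Matrix.toLin' M.A) (-α)) :
    ShiftBT.IsAsymptoticallyStable M.A ∧
    ∀ (z₀ : Fin q → ℝ) (u : ℝ → (Fin m → ℝ))
      (x : ℝ → (Fin n → ℝ)) (xr : ℝ → (Fin r → ℝ)) (y yr : ℝ → (Fin p → ℝ)),
      ShiftBT.IsStateTrajectory A B u (X₀ *ᵥ z₀) x →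
      (∀ t, 0 ≤ t → y t = C *ᵥ x t + D *ᵥ u t) →
      ShiftBT.IsStateTrajectory M.A M.B u (M.X₀ *ᵥ z₀) xr →
      (∀ t, 0 ≤ t → yr t = M.C *ᵥ xr t + M.D *ᵥ u t + M.f z₀ t) →
      yr 0 = y 0 ∧
      (ShiftBT.MemL2 u →
        ShiftBT.MemL2 (fun t => y t - yr t) ∧
        ShiftBT.normL2 (fun t => y t - yr t) ≤
          2 * (∑ i ∈ Finset.univ.filter (fun i : Fin n => r ≤ (i : ℕ)), η i) *
            (ShiftBT.normL2 u + β * ‖(WithLp.toLp 2 z₀ : EuclideanSpace ℝ (Fin q))‖)) := by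
  subst hM
  obtain ⟨R, L, hRL, rfl, rfl⟩ := hBT.exists_isBalancing
  have hη₀ : ∀ i, 0 ≤ η i := hBT.2.1
  have hlt : ∀ k, ∀ j ∉ Set.range (Fin.castLE hrn.le), η j < η (Fin.castLE hrn.le k) :=
    fun k j hj => ShiftBT.lt_castLE_of_gap hBT.1 hrn (Nat.sub_add_cancel hr) hgap k hj
  have hpos : ∀ k, 0 < η (Fin.castLE hrn.le k) := fun k =>
    (hη₀ _).trans_lt (hlt k ⟨r, hrn⟩ (by simp [Fin.range_castLE]))
  have hinj := Fin.castLE_injective hrn.le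
  refine ⟨hRL.isAsymptoticallyStable hA hinj hη₀ hpos fun k j hj => (hlt k j hj).ne,
    fun z₀ u x xr y yr hx hy hxr hyr => ?_⟩
  have hx' := hx.shift rfl hα hβ.ne'
  have hxr' := hxr.shift_jShiftBT hspec hα hβ.ne'
  have herr := fun t ht => (congrArg₂ (· - ·) (hy t ht) (hyr t ht)).trans
    (ShiftBT.jShiftBT_output_sub (x t) (xr t) (D *ᵥ u t) t)
  refine ⟨?_, fun hu => ?_⟩
  · rw [eq_comm, ← sub_eq_zero, herr 0 le_rfl, hx'.apply_zero, hxr'.apply_zero]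
    simp only [mulVec_zero, sub_self]
  rw [← ShiftBT.compl_image_castLE hrn.le]
  exact hRL.memL2_output_sub hη₀ hinj hpos hx' hxr' (hu.isLocallyL2_extendedInput hα)
    (fun T => hu.l2Norm_extendedInput_le hα hβ.le) herr
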